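/- Let $k$ be an algebraically closed field and $S=k[x_0,\dots,x_n]$. Let $X\subset\mathbb{P}^n$ be an irreducible projective variety over $k$ (reduced, Zariski closed) that is nondegenerate (contained in no hyperplane) and whose homogeneous ideal $I_X\subset S$ is generated by quadrics. Let $F_\bullet\to I_X$ be a minimal graded free resolution, and for $p\ge 0$ let $V_p$ be the $k$-vector space spanned by the basis elements of degree $p+2$ of $F_p$, so that $$I_X\leftarrow V_0\otimes S(-2)\xleftarrow{\varphi_1}V_1\otimes S(-3)\xleftarrow{\varphi_2}\cdots$$ is the linear strand. An element $s\in V_p$ is called a $p$-th (linear) syzygy of $X$. For $p\ge 1$ its image $\tilde\varphi_p(s)\in V_{p-1}\otimes S_1\cong\mathrm{Hom}(V_{p-1}^*,S_1)$ is a linear map, and the rank of $s$ is the rank of this map, that is, the number of linearly independent linear forms involved in $s$. Let $p\ge 1$ and suppose that $X$ has a $p$-th syzygy $s\in V_p$ of rank $p+2$. Then $X$ is contained in a rational normal scroll $Y\subset\mathbb{P}^n$ (possibly a cone) of degree $p+2$ and codimension $p+1$. Here a rational normal scroll is a variety that is, up to a linear change of coordinates, of the form $S(a_1,\dots,a_d)\subset\mathbb{P}^n$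 with $d\ge1$, all $a_i\ge 0$, not all $a_i$ zero, and $n+1=\sum_i(a_i+1)$: choose complementary linear subspaces $\mathbb{P}^{a_i}\subset\mathbb{P}^n$ and a rational normal curve $\phi_i:\mathbb{P}^1\to\mathbb{P}^{a_i}$ of degree $a_i$ in each (a constant map to a point if $a_i=0$), and take the union over $t\in\mathbb{P}^1$ of the linear spans of $\phi_1(t),\dots,\phi_d(t)$. -/

import Mathlib

open scoped LinearAlgebra.Projectivization

noncomputable section

namespace ScrollarSyzygy

/-- The homogeneous coordinate ring `k[x₀, …, xₙ]` of `ℙⁿ`. -/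
abbrev CoordRing (k : Type*) [Field k] (n : ℕ) : Type _ := MvPolynomial (Fin (n + 1)) k

/-- The points of projective `n`-space over `k`. -/
abbrev ProjSpace (k : Type*) [Field k] (n : ℕ) : Type _ := ℙ k (Fin (n + 1) → k)

section Varieties

variable {k : Type*} [Field k] {n : ℕ}

/-- `f` vanishes at the projective point `P`: it is zero at every vector of homogeneous
coordinates of `P`. -/
def VanishesAt (f : CoordRing k n) (P : ProjSpace k n) : Prop :=
  ∀ (v : Fin (n + 1) → k) (hv : v ≠ 0),
    Projectivization.mk k v hv = P → MvPolynomial.eval v f = 0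

/-- The projective zero locus of a set of polynomials. -/
def projZeros (T : Set (CoordRing k n)) : Set (ProjSpace k n) :=
  {P | ∀ f ∈ T, VanishesAt f P}

/-- Zariski closed subsets of `ℙⁿ`. -/
def IsZariskiClosed (X : Set (ProjSpace k n)) : Prop :=
  ∃ T : Set (CoordRing k n), X = projZeros T

/-- Irreducible projective varieties: nonempty Zariski closed subsets of `ℙⁿ` that are not
covered by two closed sets unless one of them already contains `X`. -/
def IsIrreducibleVariety (X : Set (ProjSpace k n)) : Prop :=
  IsZariskiClosed X ∧ X.Nonempty ∧
    ∀ A B : Set (ProjSpace k n), IsZariskiClosed A → IsZariskiClosed B →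
      X ⊆ A ∪ B → X ⊆ A ∨ X ⊆ B

/-- The ideal `I_X` of all polynomials vanishing on `X`. -/
def vanishingIdeal (X : Set (ProjSpace k n)) : Ideal (CoordRing k n) where
  carrier := {f | ∀ P ∈ X, VanishesAt f P}
  zero_mem' := by
    intro P _ v hv _
    simp
  add_mem' := by
    intro f g hf hg P hP v hv h
    simp [hf P hP v hv h, hg P hP v hv h]
  smul_mem' := by
    intro c f hf P hP v hv h
    simp [hf P hP v hv h]

/-- `X` lies in no hyperplane. -/
def IsNondegenerate (X : Set (ProjSpace k n)) : Prop :=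
  ∀ l : CoordRing k n, l.IsHomogeneous 1 → l ∈ vanishingIdeal X → l = 0

/-- The ideal `I` is generated by quadratic forms. -/
def IsGeneratedByQuadrics (I : Ideal (CoordRing k n)) : Prop :=
  I = Ideal.span {q | q ∈ I ∧ q.IsHomogeneous 2}

/-- The Hilbert function of `X`: the dimension of the degree `m` part of `k[x₀, …, xₙ] / I_X`. -/
def hilbertFunction (X : Set (ProjSpace k n)) (m : ℕ) : ℕ :=
  Module.finrank k
    ((MvPolynomial.homogeneousSubmodule (Fin (n + 1)) k m).map
      (Ideal.Quotient.mkₐ k (vanishingIdeal X)).toLinearMap)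

/-- `H` is the Hilbert polynomial of `X`. -/
def IsHilbertPolynomial (X : Set (ProjSpace k n)) (H : Polynomial ℚ) : Prop :=
  ∀ᶠ m : ℕ in Filter.atTop, (hilbertFunction X m : ℚ) = H.eval (m : ℚ)

/-- `X` has codimension `c` in `ℙⁿ`; the dimension of a nonempty `X` is the degree of its
Hilbert polynomial. -/
def HasCodimension (X : Set (ProjSpace k n)) (c : ℕ) : Prop :=
  ∃ H : Polynomial ℚ, H ≠ 0 ∧ IsHilbertPolynomial X H ∧ H.natDegree + c = n

/-- `X ⊆ ℙⁿ` has degree `e`: the leading coefficient of its Hilbert polynomial is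
`e / (dim X)!`. -/
def HasDegree (X : Set (ProjSpace k n)) (e : ℕ) : Prop :=
  ∃ H : Polynomial ℚ, H ≠ 0 ∧ IsHilbertPolynomial X H ∧
    H.leadingCoeff * (H.natDegree.factorial : ℚ) = (e : ℚ)

/-- Rational normal scrolls (cones included). Up to a linear change of coordinates `Y` is the
scroll `S(a₁, …, a_d) ⊆ ℙⁿ`, where `n + 1 = ∑ (aᵢ + 1)`, all `aᵢ ≥ 0` and not all `aᵢ` vanish:
the union over `[u : w] ∈ ℙ¹` of the linear spans of the `d` points
`[u ^ aᵢ : u ^ (aᵢ - 1) w : … : w ^ aᵢ]` on rational normal curves of degree `aᵢ` in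
complementary linear subspaces `ℙ^{aᵢ}` (a point if `aᵢ = 0`). -/
def IsRationalNormalScroll (Y : Set (ProjSpace k n)) : Prop :=
  ∃ (d : ℕ) (a : Fin d → ℕ) (e : (Fin (n + 1) → k) ≃ₗ[k] ((Σ i : Fin d, Fin (a i + 1)) → k)),
    (∃ i, 0 < a i) ∧
    Y = {P | ∃ (u w : k) (c : Fin d → k), (u ≠ 0 ∨ w ≠ 0) ∧
      ∀ (i : Fin d) (j : Fin (a i + 1)),
        e P.rep ⟨i, j⟩ = c i * (u ^ (a i - (j : ℕ)) * w ^ (j : ℕ))}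

end Varieties

/-- A minimal graded free resolution
`0 ← I ← F₀ ← F₁ ← F₂ ← …` of an ideal `I` of `S = k[x₀, …, xₙ]`, where `Fᵢ` is free on finitely
many homogeneous basis elements: `Fᵢ = ⨁_b S(-deg i b)`. -/
structure MinimalFreeResolution {k : Type*} [Field k] {n : ℕ} (I : Ideal (CoordRing k n)) where
  /-- the rank of `Fᵢ` -/
  rk : ℕ → ℕ
  /-- the degrees of the basis elements of `Fᵢ` -/
  deg : (i : ℕ) → Fin (rk i) → ℕ
  /-- the augmentation `F₀ → S`, with image `I` -/
  aug : (Fin (rk 0) → CoordRing k n) →ₗ[CoordRing k n] CoordRing k n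
  /-- the differential `F_{i+1} → Fᵢ` -/
  diff : (i : ℕ) → (Fin (rk (i + 1)) → CoordRing k n) →ₗ[CoordRing k n]
    (Fin (rk i) → CoordRing k n)
  /-- the augmentation preserves degrees -/
  aug_homogeneous : ∀ b, (aug (Pi.single b 1)).IsHomogeneous (deg 0 b)
  /-- the differentials preserve degrees -/
  diff_homogeneous : ∀ i b a, diff i (Pi.single b 1) a = 0 ∨
    ∃ e, deg i a + e = deg (i + 1) b ∧ (diff i (Pi.single b 1) a).IsHomogeneous e
  range_aug : LinearMap.range aug = I
  exact_zero : Function.Exact (diff 0) aug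
  exact_succ : ∀ i, Function.Exact (diff (i + 1)) (diff i)
  /-- minimality: the entries of the matrices of the differentials have no constant term -/
  minimal : ∀ i b a, MvPolynomial.constantCoeff (diff i (Pi.single b 1) a) = 0

namespace MinimalFreeResolution

variable {k : Type*} [Field k] {n : ℕ} {I : Ideal (CoordRing k n)}

/-- The space `V_p` of the linear strand `V₀ ⊗ S(-2) ← V₁ ⊗ S(-3) ← …`: the `k`-vector space on
the basis elements of degree `p + 2` of `F_p`. Its elements are the `p`-th (linear) syzygies. -/
abbrev LinearSyzygy (F : MinimalFreeResolution I) (p : ℕ) : Type _ :=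
  {b : Fin (F.rk p) // F.deg p b = p + 2} → k

/-- The inclusion of `V_p` in `F_p`. -/
def toFree (F : MinimalFreeResolution I) {p : ℕ} (s : F.LinearSyzygy p) :
    Fin (F.rk p) → CoordRing k n :=
  ∑ b : {b : Fin (F.rk p) // F.deg p b = p + 2}, Pi.single b.1 (MvPolynomial.C (s b))

/-- The space `L_s` of linear forms involved in a `p`-th syzygy `s`: the image of
`V_{p-1}^* → V` given by the tensor `φ_p(s) ∈ V_{p-1} ⊗ V`, in other words the span of the
coefficients of `φ_p(s)` at the basis of `V_{p-1}`. It is meaningful for `p ≥ 1` only. -/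
def involvedForms (F : MinimalFreeResolution I) :
    {p : ℕ} → F.LinearSyzygy p → Submodule k (CoordRing k n)
  | 0, _ => ⊥
  | q + 1, s => Submodule.span k
      (Set.range fun a : {a : Fin (F.rk q) // F.deg q a = q + 2} =>
        F.diff q (F.toFree s) a.1)

/-- The rank of a `p`-th syzygy (`p ≥ 1`): the number of linearly independent linear forms
involved in it. -/
def syzygyRank (F : MinimalFreeResolution I) {p : ℕ} (s : F.LinearSyzygy p) : ℕ :=
  Module.finrank k (F.involvedForms s)

end MinimalFreeResolution

end ScrollarSyzygy

end

/-!
A `p`-th syzygy `s` of rank `g = p + 2` gives a `2 × g` matrix of linear forms whose `2 × 2` minors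
vanish on `X`, and such a matrix, being `1`-generic, defines a rational normal scroll.

*From the syzygy to the matrix.* Let `l₁, …, l_g` be a basis of the forms involved in `s` and let
`W` be a vector space of dimension `g`. The Koszul complex of the `l_j` maps to the linear strand:
starting from `s` there are alternating forms `ψ_i` on `W` in `i` variables with values in `V_{p-i}`
such that `φ (ψ_i ω) = ∑ l_j ψ_{i+1} (e_j, ω)`. The step from `i` to `i + 1` is the exactness of the
Koszul complex at a term with linear coefficients (`exists_alternating_of_koszul_relation`), and
minimality of the resolution keeps all `ψ_i` nonzero (`exists_koszul_lift`). In the end one has a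
nonzero alternating form on `W` in `p = g - 2` variables with quadrics of `I_X` as values. Its dual
is a skew-symmetric matrix `Q` with `l_i Q_{jm} - l_j Q_{im} + l_m Q_{ij} = 0`, and this forces
`Q_{ij} = a_i l_j - a_j l_i` for linear forms `a_i` (`exists_minors_of_koszul_relation`).

*From the matrix to the scroll.* Let `U` be the span of the `l_j` in the space `V` of linear forms
and let `N` map `l_j` to `a_j`. An eigenvector of `N` in `U` would produce a product of two linear
forms in `I_X`, which is impossible because `X` is irreducible and nondegenerate
(`eq_zero_of_apply_eq_smul`). Hence `V` has a basis of chains `x, N x, …, N ^ b x` in which the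
vectors other than the ends of the chains form a basis of `U` (`exists_chain_basis`; this is
Kronecker's normal form of a pencil without degenerate members, obtained by passing from `U ⊆ V` to
`U ∩ N⁻¹ U ⊆ U`). In the coordinates given by this basis the vanishing of the minors says
that a point lies on the scroll `S(b₁, …, b_d)`, where the `i`-th chain has `b_i + 1` vectors, so that
`∑ b_i = g` and `d + g = n + 1`.

*Degree and codimension.* The part of degree `m` of the coordinate ring of the scroll is spanned
by the monomials `∏ c_i ^ α_i * w ^ γ` with `∑ α_i = m` and `γ ≤ ∑ b_i α_i`. Counting them gives
the Hilbert polynomial (`card_scrollExponents_eq_eval`).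
-/

noncomputable section

namespace ScrollarSyzygy

/-! ### Chains of a partially defined endomorphism -/

section Chains

variable {k E : Type*} [Field k] [AddCommGroup E] [Module k E]

theorem exists_disjoint_sup_eq {W V : Submodule k E} (h : W ≤ V) :
    ∃ C : Submodule k E, Disjoint W C ∧ W ⊔ C = V := by
  obtain ⟨C, hC⟩ := Submodule.exists_isCompl W
  refine ⟨C ⊓ V, hC.disjoint.mono_right inf_le_left, ?_⟩
  rw [← sup_inf_assoc_of_le C h, hC.sup_eq_top, top_inf_eq]

/-- The family of all vectors `N ^ j (x i)` with `j < a i`. -/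
def chain (N : E →ₗ[k] E) {ι : Type} (a : ι → ℕ) (x : ι → E) (p : Σ i, Fin (a i)) : E :=
  (N ^ (p.2 : ℕ)) (x p.1)

theorem chain_mem_span (N : E →ₗ[k] E) {ι : Type} (a : ι → ℕ) (x : ι → E) {i : ι} {j : ℕ}
    (hj : j < a i) : (N ^ j) (x i) ∈ Submodule.span k (Set.range (chain N a x)) :=
  Submodule.subset_span ⟨⟨i, ⟨j, hj⟩⟩, rfl⟩

theorem linearIndependent_chain (N : E →ₗ[k] E) {ι : Type} {a : ι → ℕ} {x : ι → E}
    (hli : LinearIndependent k (chain N (fun i => a i + 1) x)) :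
    LinearIndependent k (chain N a x) := by
  let r : (Σ i, Fin (a i)) → Σ i, Fin (a i + 1) := fun p => ⟨p.1, p.2.castSucc⟩
  have hr : Function.Injective r := by
    rintro ⟨i, j⟩ ⟨i', j'⟩ h
    have hi : i = i' := congrArg Sigma.fst h
    subst hi
    have hj : j = j' := by simpa [r] using h
    rw [hj]
  have hchain : chain N a x = chain N (fun i => a i + 1) x ∘ r := rfl
  rw [hchain]
  exact hli.comp r hr

/-- The last vectors of the chains of `U` map to vectors independent modulo `U`. -/
theorem eq_zero_of_sum_mem (N : E →ₗ[k] E) {U : Submodule k E} {ι : Type} [Fintype ι]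
    {a : ι → ℕ} {x : ι → E}
    (hli : LinearIndependent k (chain N (fun i => a i + 1) x))
    (hU : Submodule.span k (Set.range (chain N (fun i => a i + 1) x)) = U)
    (hU₁ : Submodule.span k (Set.range (chain N a x)) = U ⊓ U.comap N)
    {c : ι → k} (hc : ∑ i, c i • (N ^ (a i + 1)) (x i) ∈ U) : c = 0 := by
  have hlast : LinearIndependent k (fun i => (N ^ (a i)) (x i)) :=
    hli.comp (fun i => (⟨i, Fin.last (a i)⟩ : Σ i, Fin (a i + 1))) fun i j h => by
      simpa using congrArg Sigma.fst h
  have hmem : ∑ i, c i • (N ^ (a i)) (x i) ∈ Submodule.span k (Set.range (chain N a x)) := by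
    rw [hU₁]
    refine ⟨?_, ?_⟩
    · refine Submodule.sum_mem _ fun i _ => Submodule.smul_mem _ _ ?_
      rw [← hU]
      exact chain_mem_span N (fun i => a i + 1) x (Nat.lt_succ_self _)
    · rw [SetLike.mem_coe, Submodule.mem_comap, map_sum]
      simpa only [map_smul, ← Module.End.mul_apply, ← pow_succ'] using hc
  have hdisj := hli.disjoint_span_image
    (s := Set.range fun i => (⟨i, Fin.last (a i)⟩ : Σ i, Fin (a i + 1)))
    (t := Set.range fun p : Σ i, Fin (a i) => (⟨p.1, p.2.castSucc⟩ : Σ i, Fin (a i + 1))) (by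
      rw [Set.disjoint_left]
      rintro _ ⟨i, rfl⟩ ⟨⟨i', j⟩, h⟩
      simp only [Sigma.mk.injEq] at h
      obtain ⟨rfl, h⟩ := h
      exact (Fin.castSucc_lt_last j).ne (eq_of_heq h))
  rw [Submodule.disjoint_def] at hdisj
  have hzero := hdisj (∑ i, c i • (N ^ (a i)) (x i))
    (Submodule.sum_mem _ fun i _ => Submodule.smul_mem _ _
      (Submodule.subset_span ⟨_, ⟨i, rfl⟩, rfl⟩))
    (by
      refine Submodule.span_mono ?_ hmem
      rintro _ ⟨p, rfl⟩
      exact ⟨_, ⟨p, rfl⟩, rfl⟩)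
  exact funext (Fintype.linearIndependent_iff.1 hlast c hzero)

/-- Kronecker's normal form for a linear map `N` from `U` to `V ⊇ U` without eigenvectors: `V` has
a basis of chains `x, N x, …, N ^ a x`, and the vectors other than the ends of the chains form a
basis of `U`. -/
theorem exists_chain_basis [IsAlgClosed k] (N : E →ₗ[k] E) (m : ℕ) :
    ∀ (U V : Submodule k E) [FiniteDimensional k V], Module.finrank k V = m → U ≤ V →
      U.map N ≤ V → (∀ u ∈ U, ∀ c : k, N u = c • u → u = 0) →
      ∃ (ι : Type) (_ : Fintype ι) (a : ι → ℕ) (x : ι → E),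
        LinearIndependent k (chain N (fun i => a i + 1) x) ∧
        Submodule.span k (Set.range (chain N (fun i => a i + 1) x)) = V ∧
        Submodule.span k (Set.range (chain N a x)) = U := by
  induction m using Nat.strong_induction_on with
  | _ m ih =>
  intro U V _ hm hUV hNU heig
  rcases hUV.eq_or_lt with rfl | hlt
  · -- `N` maps `U` to itself without eigenvectors, so `U = 0`
    have hbot : U = ⊥ := by
      by_contra hne
      have : Nontrivial U := Submodule.nontrivial_iff_ne_bot.2 hne
      have hmaps : ∀ u ∈ U, N u ∈ U := fun u hu => hNU ⟨u, hu, rfl⟩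
      obtain ⟨c, hc⟩ := Module.End.exists_eigenvalue (N.restrict hmaps)
      obtain ⟨u, hu⟩ := hc.exists_hasEigenvector
      refine hu.2 (Subtype.ext (heig u u.2 c ?_))
      simpa using congrArg Subtype.val hu.apply_eq_smul
    refine ⟨Empty, inferInstance, Empty.elim, Empty.elim, ?_, ?_, ?_⟩
    · exact linearIndependent_empty_type
    · rw [Set.range_eq_empty, Submodule.span_empty, hbot]
    · rw [Set.range_eq_empty, Submodule.span_empty, hbot]
  have : FiniteDimensional k U := Submodule.finiteDimensional_of_le hUV
  -- the induction hypothesis applies to the smaller pair `U ∩ N⁻¹ U ⊆ U`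
  obtain ⟨ι, _, a, x, hli, hU, hU₁⟩ := ih _ (hm ▸ Submodule.finrank_lt_finrank_of_lt hlt)
    (U ⊓ U.comap N) U rfl inf_le_left
    (by rintro _ ⟨u, hu, rfl⟩; exact hu.2) (fun u hu => heig u hu.1)
  obtain ⟨C, hdisj, hsup⟩ := exists_disjoint_sup_eq (sup_le hUV hNU)
  have : FiniteDimensional k C := Submodule.finiteDimensional_of_le (hsup ▸ le_sup_right)
  let y := Module.finBasis k C
  have hpow : ∀ i, (N ^ (a i + 1)) (x i) ∈ U.map N := fun i => by
    rw [pow_succ', Module.End.mul_apply]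
    refine Submodule.mem_map_of_mem ?_
    rw [← hU]
    exact chain_mem_span N (fun i => a i + 1) x (Nat.lt_succ_self _)
  have hli₁ : LinearIndependent k (fun i => (N ^ (a i + 1)) (x i)) :=
    Fintype.linearIndependent_iff.2 fun c hc => congrFun
      (eq_zero_of_sum_mem N hli hU hU₁ (by rw [hc]; exact U.zero_mem))
  have hdisj₁ : Disjoint (Submodule.span k (Set.range (chain N (fun i => a i + 1) x)))
      (Submodule.span k (Set.range fun i => (N ^ (a i + 1)) (x i))) := by
    rw [hU, Submodule.disjoint_def]
    intro v hv hv'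
    obtain ⟨c, rfl⟩ := (Submodule.mem_span_range_iff_exists_fun k).1 hv'
    simp [eq_zero_of_sum_mem N hli hU hU₁ hv]
  have hli₂ := hli.sum_type hli₁ hdisj₁
  have hspany : Submodule.span k (Set.range fun t => (y t : E)) = C := by
    have := congrArg (Submodule.map C.subtype) y.span_eq
    rw [Submodule.map_span, ← Set.range_comp, Submodule.map_top, Submodule.range_subtype] at this
    exact this
  have hli₃ := hli₂.sum_type (y.linearIndependent.map' C.subtype (by simp)) (by
    refine hdisj.mono (Submodule.span_le.2 ?_) hspany.le
    rintro _ ⟨p | i, rfl⟩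
    · exact Submodule.mem_sup_left (hU.le (Submodule.subset_span ⟨p, rfl⟩))
    · exact Submodule.mem_sup_right (hpow i))
  -- extend every chain of `U` by one vector and add the basis of `C` as chains of length one
  let a' : ι ⊕ Fin (Module.finrank k C) → ℕ := Sum.elim (fun i => a i + 1) (fun _ => 0)
  let x' : ι ⊕ Fin (Module.finrank k C) → E := Sum.elim x (fun t => (y t : E))
  let g : (Σ i, Fin (a' i + 1)) → ((Σ i, Fin (a i + 1)) ⊕ ι) ⊕ Fin (Module.finrank k C)
    | ⟨Sum.inl i, j⟩ => if h : (j : ℕ) < a i + 1 then Sum.inl (Sum.inl ⟨i, ⟨j, h⟩⟩)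
        else Sum.inl (Sum.inr i)
    | ⟨Sum.inr t, _⟩ => Sum.inr t
  have hg : Function.Injective g := by
    rintro ⟨i | t, j⟩ ⟨i' | t', j'⟩ h
    · simp only [g] at h
      split_ifs at h with h₁ h₂ h₂
      · simp only [Sum.inl.injEq, Sigma.mk.injEq] at h
        obtain ⟨rfl, h⟩ := h
        have := Fin.val_eq_of_eq (eq_of_heq h)
        simp only at this
        simp [Fin.ext_iff, this]
      · simp at h
      · simp at h
      · simp only [Sum.inl.injEq, Sum.inr.injEq] at h
        subst h
        have h3 := j.2
        have h4 := j'.2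
        simp only [a', Sum.elim_inl] at h3 h4
        have : j = j' := Fin.ext (by omega)
        rw [this]
    · simp only [g] at h
      split_ifs at h
    · simp only [g] at h
      split_ifs at h
    · simp only [g, Sum.inr.injEq] at h
      subst h
      have h3 := j.2
      have h4 := j'.2
      simp only [a', Sum.elim_inr] at h3 h4
      have : j = j' := Fin.ext (by omega)
      rw [this]
  have hchain : chain N (fun i => a' i + 1) x' =
      Sum.elim (Sum.elim (chain N (fun i => a i + 1) x) (fun i => (N ^ (a i + 1)) (x i)))
        (C.subtype ∘ y) ∘ g := by
    funext ⟨i, j⟩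
    rcases i with i | t
    · simp only [g, Function.comp_apply]
      split_ifs with h
      · rfl
      · have h3 := j.2
        simp only [a', Sum.elim_inl] at h3
        have : (j : ℕ) = a i + 1 := by omega
        simp [chain, this, x']
    · have h3 := j.2
      simp only [a', Sum.elim_inr] at h3
      have : (j : ℕ) = 0 := by omega
      simp [chain, this, x', g]
  refine ⟨ι ⊕ Fin (Module.finrank k C), inferInstance, a', x', ?_, ?_, ?_⟩
  · rw [hchain]
    exact hli₃.comp g hg
  · refine le_antisymm (Submodule.span_le.2 ?_) ?_
    · rw [hchain]
      rintro _ ⟨p, rfl⟩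
      rw [Function.comp_apply]
      rcases g p with (q | i) | t
      · exact hUV (hU.le (Submodule.subset_span ⟨q, rfl⟩))
      · exact hNU (hpow i)
      · exact hsup.le (Submodule.mem_sup_right (y t).2)
    · have hle : U ≤ Submodule.span k (Set.range (chain N (fun i => a' i + 1) x')) := by
        rw [← hU, Submodule.span_le]
        rintro _ ⟨⟨i, j⟩, rfl⟩
        exact chain_mem_span N (fun i => a' i + 1) x' (i := Sum.inl i)
          (lt_of_lt_of_le j.2 (Nat.le_succ _))
      rw [← hsup]
      refine sup_le (sup_le hle ?_) ?_
      · rw [← hU, Submodule.map_span, Submodule.span_le]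
        rintro _ ⟨_, ⟨⟨i, j⟩, rfl⟩, rfl⟩
        rw [chain, ← Module.End.mul_apply, ← pow_succ']
        exact chain_mem_span N (fun i => a' i + 1) x' (i := Sum.inl i)
          (Nat.succ_lt_succ j.2)
      · refine hspany.ge.trans (Submodule.span_le.2 ?_)
        rintro _ ⟨t, rfl⟩
        exact chain_mem_span N (fun i => a' i + 1) x' (i := Sum.inr t) (j := 0)
          (Nat.succ_pos _)
  · rw [← hU]
    congr 1
    ext v
    constructor
    · rintro ⟨⟨i | t, j⟩, rfl⟩
      · exact ⟨⟨i, j⟩, rfl⟩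
      · exact j.elim0
    · rintro ⟨⟨i, j⟩, rfl⟩
      exact ⟨⟨Sum.inl i, j⟩, rfl⟩

theorem exists_fin_chain_basis [IsAlgClosed k] (N : E →ₗ[k] E) (U V : Submodule k E)
    [FiniteDimensional k V] (hUV : U ≤ V) (hNU : U.map N ≤ V)
    (heig : ∀ u ∈ U, ∀ c : k, N u = c • u → u = 0) :
    ∃ (d : ℕ) (a : Fin d → ℕ) (x : Fin d → E),
      LinearIndependent k (chain N (fun i => a i + 1) x) ∧
      Submodule.span k (Set.range (chain N (fun i => a i + 1) x)) = V ∧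
      Submodule.span k (Set.range (chain N a x)) = U := by
  obtain ⟨ι, _, a, x, hli, hV, hU⟩ := exists_chain_basis N _ U V rfl hUV hNU heig
  let e := (Fintype.equivFin ι).symm
  have hrange : ∀ f : ι → ℕ, Set.range (chain N (f ∘ e) (x ∘ e)) = Set.range (chain N f x) := by
    intro f
    ext v
    constructor
    · rintro ⟨⟨i, j⟩, rfl⟩
      exact ⟨⟨e i, j⟩, rfl⟩
    · rintro ⟨⟨i, j⟩, rfl⟩
      obtain ⟨i, rfl⟩ := e.surjective i
      exact ⟨⟨i, j⟩, rfl⟩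
  refine ⟨Fintype.card ι, a ∘ e, x ∘ e, ?_, ?_, ?_⟩
  · let r : (Σ i, Fin (a (e i) + 1)) → Σ i, Fin (a i + 1) := fun p => ⟨e p.1, p.2⟩
    have hr : Function.Injective r := by
      rintro ⟨i, j⟩ ⟨i', j'⟩ h
      have hi : i = i' := e.injective (congrArg Sigma.fst h)
      subst hi
      have hj : j = j' := by simpa [r] using h
      rw [hj]
    have hchain : chain N (fun i => (a ∘ e) i + 1) (x ∘ e) =
        chain N (fun i => a i + 1) x ∘ r := rfl
    rw [hchain]
    exact hli.comp r hr
  · exact (congrArg (Submodule.span k) (hrange fun i => a i + 1)).trans hV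
  · exact (congrArg (Submodule.span k) (hrange a)).trans hU

end Chains

/-! ### Relations between linear forms -/

section LinearForms

variable {k : Type*} [Field k] {σ : Type*}

theorem eval_add_of_isHomogeneous_one {f : MvPolynomial σ k} (hf : f.IsHomogeneous 1)
    (v w : σ → k) :
    MvPolynomial.eval (v + w) f = MvPolynomial.eval v f + MvPolynomial.eval w f := by
  have hf' : f ∈ Submodule.span k (Set.range MvPolynomial.X) := by
    rwa [← MvPolynomial.homogeneousSubmodule_one_eq_span_X]
  clear hf
  induction hf' using Submodule.span_induction with
  | mem f hf => obtain ⟨i, rfl⟩ := hf; simp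
  | zero => simp
  | add f g _ _ hf hg => simp only [map_add, hf, hg]; ring
  | smul c f _ hf => simp only [MvPolynomial.smul_eval, hf]; ring

theorem eval_smul_of_isHomogeneous_one {f : MvPolynomial σ k} (hf : f.IsHomogeneous 1)
    (c : k) (v : σ → k) :
    MvPolynomial.eval (c • v) f = c * MvPolynomial.eval v f := by
  have hf' : f ∈ Submodule.span k (Set.range MvPolynomial.X) := by
    rwa [← MvPolynomial.homogeneousSubmodule_one_eq_span_X]
  clear hf
  induction hf' using Submodule.span_induction with
  | mem f hf => obtain ⟨i, rfl⟩ := hf; simp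
  | zero => simp
  | add f g _ _ hf hg => simp only [map_add, hf, hg]; ring
  | smul a f _ hf => simp only [MvPolynomial.smul_eval, hf]; ring

/-- Independent linear forms admit dual points: points at which exactly one of the forms takes
the value `1` and all the others vanish. -/
theorem exists_dual_points [Infinite k] {ι : Type*} [Fintype ι] [DecidableEq ι]
    {l : ι → MvPolynomial σ k} (hl : ∀ j, (l j).IsHomogeneous 1) (hli : LinearIndependent k l) :
    ∃ w : ι → σ → k, ∀ j m, MvPolynomial.eval (w m) (l j) = if j = m then 1 else 0 := by
  let Φ : (σ → k) →ₗ[k] (ι → k) :=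
    { toFun := fun v j => MvPolynomial.eval v (l j)
      map_add' := fun v w => funext fun j => eval_add_of_isHomogeneous_one (hl j) v w
      map_smul' := fun c v => funext fun j => eval_smul_of_isHomogeneous_one (hl j) c v }
  have hsurj : LinearMap.range Φ = ⊤ := by
    by_contra hne
    obtain ⟨f, hf, hker⟩ := Submodule.exists_le_ker_of_lt_top _ (lt_top_iff_ne_top.2 hne)
    refine hf (LinearMap.pi_ext' fun j => LinearMap.ext_ring ?_)
    have hsum : ∑ j, f (Pi.single j 1) • l j = 0 := by
      refine MvPolynomial.funext_iff.2 fun v => ?_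
      have h0 : f (Φ v) = 0 := hker ⟨v, rfl⟩
      rw [LinearMap.pi_apply_eq_sum_univ f] at h0
      simp only [map_sum, MvPolynomial.smul_eval, map_zero]
      rw [← h0]
      refine Finset.sum_congr rfl fun j _ => ?_
      rw [smul_eq_mul, mul_comm]
      congr 2
      ext i
      simp [Pi.single_apply, eq_comm]
    simpa using Fintype.linearIndependent_iff.1 hli _ hsum j
  have hex : ∀ m : ι, ∃ v, Φ v = Pi.single m 1 := fun m =>
    LinearMap.range_eq_top.1 hsurj _
  choose w hw using hex
  refine ⟨w, fun j m => ?_⟩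
  have h : MvPolynomial.eval (w m) (l j) = (Pi.single m 1 : ι → k) j := congrFun (hw m) j
  rw [h, Pi.single_apply]

/-- A relation `∑ j, l j * f j = 0` between linear forms is a combination of the trivial ones:
`f` is given by a skew-symmetric matrix of constants, here read off at dual points. The
formula is the polarization of the relation. -/
theorem eval_add_eval_eq_zero {ι : Type*} [Fintype ι] [DecidableEq ι]
    {l f : ι → MvPolynomial σ k} {w : ι → σ → k}
    (hl : ∀ j, (l j).IsHomogeneous 1) (hf : ∀ j, (f j).IsHomogeneous 1)
    (hw : ∀ j m, MvPolynomial.eval (w m) (l j) = if j = m then 1 else 0)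
    (hrel : ∑ j, l j * f j = 0) (m : ι) (v : σ → k) :
    MvPolynomial.eval v (f m) +
      ∑ j, MvPolynomial.eval (w m) (f j) * MvPolynomial.eval v (l j) = 0 := by
  have hv := congrArg (MvPolynomial.eval v) hrel
  have hwm := congrArg (MvPolynomial.eval (w m)) hrel
  have hvw := congrArg (MvPolynomial.eval (v + w m)) hrel
  simp only [map_sum, map_mul, map_zero, eval_add_of_isHomogeneous_one (hl _),
    eval_add_of_isHomogeneous_one (hf _), add_mul, mul_add, Finset.sum_add_distrib] at hv hwm hvw
  have h1 : ∑ j, MvPolynomial.eval (w m) (l j) * MvPolynomial.eval v (f j) =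
      MvPolynomial.eval v (f m) := by simp [hw]
  have h2 : ∑ j, MvPolynomial.eval v (l j) * MvPolynomial.eval (w m) (f j) =
      ∑ j, MvPolynomial.eval (w m) (f j) * MvPolynomial.eval v (l j) :=
    Finset.sum_congr rfl fun j _ => mul_comm _ _
  rw [hv, hwm, h1, h2] at hvw
  simpa [add_comm] using hvw

theorem eval_dual_point_self {ι : Type*} [Fintype ι] [DecidableEq ι]
    {l f : ι → MvPolynomial σ k} {w : ι → σ → k}
    (hw : ∀ j m, MvPolynomial.eval (w m) (l j) = if j = m then 1 else 0)
    (hrel : ∑ j, l j * f j = 0) (m : ι) :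
    MvPolynomial.eval (w m) (f m) = 0 := by
  have hwm := congrArg (MvPolynomial.eval (w m)) hrel
  simpa [hw] using hwm

end LinearForms

section KoszulLinear

variable {k : Type*} [Field k] {σ : Type*} {g : ℕ}

/-- Exactness of the Koszul complex of independent linear forms at the terms with linear
coefficients: an alternating form `f` with values in the linear forms such that
`∑ j, l j * f (e j, ω) = 0` for all `ω` is of the form `∑ j, h (e j, ω) • l j` with a scalar
alternating form `h`. -/
theorem exists_alternating_of_koszul_relation [Infinite k]
    {l : Fin g → MvPolynomial σ k} (hl : ∀ j, (l j).IsHomogeneous 1)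
    (hli : LinearIndependent k l) {i : ℕ}
    (f : (Fin g → k) [⋀^Fin (i + 1)]→ₗ[k] MvPolynomial σ k)
    (hf : ∀ ω, (f ω).IsHomogeneous 1)
    (hrel : ∀ ω : Fin i → Fin g → k, ∑ j, l j * f (Fin.cons (Pi.single j 1) ω) = 0) :
    ∃ h : (Fin g → k) [⋀^Fin (i + 1 + 1)]→ₗ[k] k,
      ∀ ω, f ω = ∑ j, h (Fin.cons (Pi.single j 1) ω) • l j := by
  obtain ⟨w, hw⟩ := exists_dual_points hl hli
  let ev : Fin g → MvPolynomial σ k →ₗ[k] k := fun m => (MvPolynomial.aeval (w m)).toLinearMap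
  have hev : ∀ m q, ev m q = MvPolynomial.eval (w m) q := fun m q =>
    RingHom.congr_fun (MvPolynomial.coe_aeval_eq_eval (w m)) q
  let H : (Fin g → k) →ₗ[k] MultilinearMap k (fun _ : Fin (i + 1) => Fin g → k) k :=
    ∑ m, (LinearMap.proj m).smulRight ((ev m).compMultilinearMap f.toMultilinearMap)
  have hH : ∀ v ω, H v ω = ∑ m, v m * MvPolynomial.eval (w m) (f ω) := fun v ω => by
    simp [H, ← hev]
  -- linearity of `f` in its first argument
  have hexp : ∀ (v : Fin g → k) (ω : Fin i → Fin g → k),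
      f (Fin.cons v ω) = ∑ j, v j • f (Fin.cons (Pi.single j 1) ω) := fun v ω => by
    have h1 := LinearMap.pi_apply_eq_sum_univ
      (f.toMultilinearMap.toLinearMap (Fin.cons 0 ω) 0) v
    simp only [MultilinearMap.toLinearMap_apply, Fin.update_cons_zero] at h1
    refine h1.trans (Finset.sum_congr rfl fun j _ => ?_)
    have h2 : (fun i => if j = i then (1 : k) else 0) = Pi.single j 1 := by
      ext i; simp [Pi.single_apply, eq_comm]
    rw [h2]
    rfl
  have hskew : ∀ (ω : Fin i → Fin g → k) (m j : Fin g),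
      MvPolynomial.eval (w j) (f (Fin.cons (Pi.single m 1) ω)) +
        MvPolynomial.eval (w m) (f (Fin.cons (Pi.single j 1) ω)) = 0 := fun ω m j => by
    have := eval_add_eval_eq_zero hl (fun j => hf _) hw (hrel ω) m (w j)
    simpa [hw] using this
  have hdiag : ∀ (v : Fin g → k) (ω : Fin i → Fin g → k), H v (Fin.cons v ω) = 0 := fun v ω => by
    rw [hH]
    have h0 := fun m => eval_dual_point_self hw (hrel ω) m
    simp only [hexp v ω, map_sum, MvPolynomial.smul_eval, Finset.mul_sum]
    -- the terms `(m, j)` and `(j, m)` cancel, and the diagonal ones vanish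
    rw [← Finset.sum_product']
    refine Finset.sum_involution (fun p _ => (p.2, p.1)) ?_ ?_ (by simp) (by simp)
    · rintro ⟨m, j⟩ -
      linear_combination v m * v j * hskew ω m j
    · rintro ⟨m, j⟩ - hne heq
      obtain rfl : j = m := congrArg Prod.fst heq
      exact hne (by simp [h0])
  have htail : ∀ ω : Fin (i + 1 + 1) → Fin g → k, ∀ j : Fin (i + 1),
      ω 0 = ω j.succ → H (ω 0) (Fin.tail ω) = 0 := fun ω j hj => by
    have hperm : ∀ u : Fin (i + 1) → Fin g → k, H (ω 0) (u ∘ Equiv.swap 0 j) =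
        (Equiv.Perm.sign (Equiv.swap 0 j) : ℤ) • H (ω 0) u := fun u => by
      rw [hH, hH, f.map_perm, Finset.smul_sum]
      refine Finset.sum_congr rfl fun m _ => ?_
      rcases Int.units_eq_one_or (Equiv.Perm.sign (Equiv.swap 0 j)) with h | h <;> simp [h]
    have hz := hperm (Fin.tail ω)
    rw [show Fin.tail ω ∘ Equiv.swap 0 j =
      Fin.cons (ω 0) (Fin.tail (Fin.tail ω ∘ Equiv.swap 0 j)) by
        conv_lhs => rw [← Fin.cons_self_tail (Fin.tail ω ∘ Equiv.swap 0 j)]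
        simp [Fin.tail, hj], hdiag] at hz
    rcases Int.units_eq_one_or (Equiv.Perm.sign (Equiv.swap 0 j)) with h | h
    · simpa [h] using hz.symm
    · simpa [h] using hz.symm
  refine ⟨{ H.uncurryLeft with map_eq_zero_of_eq' := ?_ }, fun ω => ?_⟩
  · intro ω a b hab hne
    change H (ω 0) (Fin.tail ω) = 0
    induction a using Fin.cases with
    | zero =>
      obtain ⟨b, rfl⟩ := Fin.exists_succ_eq.2 hne.symm
      exact htail ω b hab
    | succ a =>
      induction b using Fin.cases with
      | zero => exact htail ω a hab.symm
      | succ b =>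
        rw [hH]
        refine Finset.sum_eq_zero fun m _ => ?_
        rw [f.map_eq_zero_of_eq (Fin.tail ω) hab fun h => hne (congrArg Fin.succ h)]
        simp
  · change f ω = ∑ j, H (Pi.single j 1) ω • l j
    refine MvPolynomial.funext_iff.2 fun v => ?_
    rw [map_sum]
    have hHs : ∀ j, H (Pi.single j 1) ω = MvPolynomial.eval (w j) (f ω) := fun j => by
      simp [hH, Pi.single_apply]
    simp only [MvPolynomial.smul_eval, hHs]
    have hω : ω = Fin.cons (ω 0) (Fin.tail ω) := (Fin.cons_self_tail ω).symm
    have hv : ∀ m, MvPolynomial.eval v (f (Fin.cons (Pi.single m 1) (Fin.tail ω))) =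
        ∑ j, MvPolynomial.eval (w j) (f (Fin.cons (Pi.single m 1) (Fin.tail ω))) *
          MvPolynomial.eval v (l j) := fun m => by
      have h1 := eval_add_eval_eq_zero hl (fun j => hf _) hw (hrel (Fin.tail ω)) m v
      rw [eq_neg_of_add_eq_zero_left h1, ← Finset.sum_neg_distrib]
      refine Finset.sum_congr rfl fun j _ => ?_
      rw [eq_neg_of_add_eq_zero_left (hskew (Fin.tail ω) m j)]
      ring
    rw [hω, hexp]
    simp only [map_sum, MvPolynomial.smul_eval, hv, Finset.mul_sum, Finset.sum_mul]
    rw [Finset.sum_comm]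
    simp only [mul_assoc]

end KoszulLinear

/-! ### Skew-symmetric matrices of quadrics -/

section KoszulQuadrics

variable {k : Type*} [Field k] {σ : Type*}

/-- The algebra endomorphism corresponding to the projection `v ↦ v - l(v) w`; if `l(w) = 1` it is
the restriction to the hyperplane `l = 0`. -/
def restrictHom (l : MvPolynomial σ k) (w : σ → k) : MvPolynomial σ k →ₐ[k] MvPolynomial σ k :=
  MvPolynomial.aeval fun i => MvPolynomial.X i - MvPolynomial.C (w i) * l

theorem eval_restrictHom (l : MvPolynomial σ k) (w v : σ → k) (f : MvPolynomial σ k) :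
    MvPolynomial.eval v (restrictHom l w f) =
      MvPolynomial.eval (v + (-MvPolynomial.eval v l) • w) f := by
  induction f using MvPolynomial.induction_on with
  | C a => simp [restrictHom]
  | add f g hf hg => simp [hf, hg]
  | mul_X f i hf =>
    rw [map_mul, map_mul, hf, map_mul]
    congr 1
    simp [restrictHom]
    ring

theorem dvd_sub_restrictHom (l : MvPolynomial σ k) (w : σ → k) (f : MvPolynomial σ k) :
    l ∣ f - restrictHom l w f := by
  induction f using MvPolynomial.induction_on with
  | C a => simp [restrictHom]
  | add f g hf hg =>
    rw [map_add, add_sub_add_comm]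
    exact dvd_add hf hg
  | mul_X f i hf =>
    have hX : restrictHom l w (MvPolynomial.X i) =
        MvPolynomial.X i - MvPolynomial.C (w i) * l := by simp [restrictHom]
    rw [map_mul, hX]
    obtain ⟨c, hc⟩ := hf
    refine ⟨c * MvPolynomial.X i + restrictHom l w f * MvPolynomial.C (w i), ?_⟩
    linear_combination MvPolynomial.X i * hc

theorem restrictHom_apply_dual [Infinite k] {ι : Type*} [DecidableEq ι]
    {l : ι → MvPolynomial σ k} {w : ι → σ → k} (hl : ∀ j, (l j).IsHomogeneous 1)
    (hw : ∀ j m, MvPolynomial.eval (w m) (l j) = if j = m then 1 else 0) (j m : ι) :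
    restrictHom (l m) (w m) (l j) = if j = m then 0 else l j := by
  refine MvPolynomial.funext_iff.2 fun v => ?_
  rw [eval_restrictHom, eval_add_of_isHomogeneous_one (hl j),
    eval_smul_of_isHomogeneous_one (hl j), hw]
  split_ifs with h
  · subst h; simp
  · simp

theorem homogeneousComponent_mul_of_isHomogeneous {l : MvPolynomial σ k} {m : ℕ}
    (hl : l.IsHomogeneous m) (i : ℕ) (f : MvPolynomial σ k) :
    MvPolynomial.homogeneousComponent (m + i) (l * f) =
      l * MvPolynomial.homogeneousComponent i f := by
  conv_lhs => rw [← MvPolynomial.sum_homogeneousComponent f, Finset.mul_sum, map_sum]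
  rw [Finset.sum_congr rfl fun j _ => MvPolynomial.homogeneousComponent_of_mem
    (hl.mul (MvPolynomial.homogeneousComponent_isHomogeneous j f))]
  simp only [add_right_inj, Finset.sum_ite_eq, Finset.mem_range]
  split_ifs with h
  · rfl
  · rw [MvPolynomial.homogeneousComponent_eq_zero _ _ (by omega), mul_zero]

/-- Quadrics `Q i j` with the three-term relations
`l i * Q j k - l j * Q i k + l k * Q i j = 0` against independent linear forms are the
`2 × 2` minors of a matrix with rows `a` and `l`. -/
theorem exists_minors_of_koszul_relation [Infinite k] {ι : Type*} [Fintype ι] [DecidableEq ι]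
    {l : ι → MvPolynomial σ k} (hl : ∀ j, (l j).IsHomogeneous 1) (hli : LinearIndependent k l)
    {Q : ι → ι → MvPolynomial σ k} (hQ : ∀ i j, (Q i j).IsHomogeneous 2)
    (hrel : ∀ i j m, l i * Q j m - l j * Q i m + l m * Q i j = 0)
    {i₀ i₁ i₂ : ι} (h₀₁ : i₀ ≠ i₁) (h₀₂ : i₀ ≠ i₂) (h₁₂ : i₁ ≠ i₂) :
    ∃ a : ι → MvPolynomial σ k, (∀ j, (a j).IsHomogeneous 1) ∧
      ∀ i j, Q i j = a i * l j - a j * l i := by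
  obtain ⟨w, hw⟩ := exists_dual_points hl hli
  have hne : ∀ j, l j ≠ 0 := hli.ne_zero
  let ρ := fun m => restrictHom (l m) (w m)
  have hρ : ∀ j m, ρ m (l j) = if j = m then 0 else l j := restrictHom_apply_dual hl hw
  have hdvd : ∀ m f, ρ m f = 0 → l m ∣ f := fun m f h => by
    have := dvd_sub_restrictHom (l m) (w m) f
    rwa [show restrictHom (l m) (w m) f = 0 from h, sub_zero] at this
  have hρrel : ∀ j m, j ≠ i₀ → m ≠ i₀ → l j * ρ i₀ (Q i₀ m) = l m * ρ i₀ (Q i₀ j) :=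
    fun j m hj hm => by
      have := congrArg (ρ i₀) (hrel i₀ j m)
      simp only [map_add, map_sub, map_mul, map_zero, hρ, if_neg hj, if_neg hm, if_true] at this
      linear_combination -this
  -- modulo `l i₀`, the relation for `i₀, i₁, i₂` shows that `l i₁` divides `Q i₀ i₁`; the quotient
  -- `b` will be the entry of the row `a` at `i₀`
  obtain ⟨b, hb⟩ : l i₁ ∣ ρ i₀ (Q i₀ i₁) := by
    refine hdvd i₁ _ ?_
    have := congrArg (ρ i₁) (hρrel i₁ i₂ h₀₁.symm h₀₂.symm)
    simp only [map_mul, hρ, if_true, if_neg h₁₂.symm, zero_mul] at this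
    exact (mul_eq_zero.1 this.symm).resolve_left (hne i₂)
  have hzero : ∀ i, Q i i = 0 := fun i => by
    have := hrel i i i
    rw [sub_self, zero_add] at this
    exact (mul_eq_zero.1 this).resolve_left (hne i)
  have hfirst : ∀ j, ∃ a, Q i₀ j = b * l j - a * l i₀ := fun j => by
    by_cases hj : j = i₀
    · exact ⟨b, by rw [hj, hzero, sub_self]⟩
    · have h1 : ρ i₀ (Q i₀ j) = l j * b := by
        have := hρrel i₁ j h₀₁.symm hj
        rw [hb] at this
        exact mul_left_cancel₀ (hne i₁) (by rw [this]; ring)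
      obtain ⟨c, hc⟩ := dvd_sub_restrictHom (l i₀) (w i₀) (Q i₀ j)
      rw [show restrictHom (l i₀) (w i₀) (Q i₀ j) = _ from h1] at hc
      exact ⟨-c, by linear_combination hc⟩
  choose a ha using hfirst
  have hminor : ∀ i j, Q i j = l j * a i - l i * a j := fun i j => by
    refine mul_left_cancel₀ (hne i₀) ?_
    have := hrel i₀ i j
    rw [ha i, ha j] at this
    linear_combination this
  -- only the linear part of `a j` contributes to the quadrics
  refine ⟨fun j => MvPolynomial.homogeneousComponent 1 (a j),
    fun j => MvPolynomial.homogeneousComponent_isHomogeneous 1 (a j), fun i j => ?_⟩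
  have := congrArg (MvPolynomial.homogeneousComponent (1 + 1)) (hminor i j)
  rw [map_sub, homogeneousComponent_mul_of_isHomogeneous (hl i),
    homogeneousComponent_mul_of_isHomogeneous (hl j),
    MvPolynomial.homogeneousComponent_of_mem (hQ i j), if_pos rfl] at this
  rw [this]
  ring

end KoszulQuadrics

section Star

variable {k M : Type*} [Field k] [AddCommGroup M] [Module k M] {i : ℕ}

/-- The value of an alternating form on the basis vectors not among `σ 0`, `σ 1`, with the sign of
the permutation `σ`. -/
def complementValue (f : (Fin (i + 2) → k) [⋀^Fin i]→ₗ[k] M)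
    (σ : Equiv.Perm (Fin (i + 2))) : M :=
  (Equiv.Perm.sign σ : ℤ) • f fun r => Pi.single (σ r.succ.succ) 1

/-- The value depends only on the two indices that are left out. -/
theorem complementValue_eq (f : (Fin (i + 2) → k) [⋀^Fin i]→ₗ[k] M)
    {σ τ : Equiv.Perm (Fin (i + 2))} (h₀ : σ 0 = τ 0) (h₁ : σ 1 = τ 1) :
    complementValue f σ = complementValue f τ := by
  -- `σ⁻¹ * τ` fixes `0` and `1`, so it is a permutation `π` of the remaining indices
  obtain ⟨⟨a, ρ⟩, hρ⟩ := Equiv.Perm.decomposeFin.symm.surjective (σ⁻¹ * τ)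
  have ha : a = 0 := by
    have : Equiv.Perm.decomposeFin.symm (a, ρ) 0 = 0 := by rw [hρ]; simp [← h₀]
    simpa using this
  subst ha
  obtain ⟨⟨b, π⟩, rfl⟩ := Equiv.Perm.decomposeFin.symm.surjective ρ
  have hb : b = 0 := by
    have h : Equiv.Perm.decomposeFin.symm
        ((0 : Fin (i + 2)), Equiv.Perm.decomposeFin.symm (b, π)) 1 = 1 := by
      rw [hρ]; simp [← h₁]
    rw [← Fin.succ_zero_eq_one, Equiv.Perm.decomposeFin_symm_apply_succ] at h
    exact Fin.succ_injective _ (by simpa using h)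
  subst hb
  have hτ : τ = σ * Equiv.Perm.decomposeFin.symm
      ((0 : Fin (i + 2)), Equiv.Perm.decomposeFin.symm (0, π)) := by rw [hρ]; simp
  have hsign : Equiv.Perm.sign τ = Equiv.Perm.sign σ * Equiv.Perm.sign π := by
    rw [hτ, Equiv.Perm.sign_mul]; simp
  have hf : (fun r : Fin i => (Pi.single (τ r.succ.succ) 1 : Fin (i + 2) → k)) =
      (fun r : Fin i => (Pi.single (σ r.succ.succ) 1 : Fin (i + 2) → k)) ∘ π := by
    funext r
    simp [hτ]
  rw [complementValue, complementValue, hf, f.map_perm, hsign]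
  rcases Int.units_eq_one_or (Equiv.Perm.sign π) with h | h <;> simp [h]

open Classical in
/-- The skew-symmetric matrix dual to an alternating form `f` in two variables less than the
dimension: up to the sign of the arrangement, the entry at `(a, b)` is the value of `f` on the
basis vectors other than `a` and `b`. -/
def dualMatrix (f : (Fin (i + 2) → k) [⋀^Fin i]→ₗ[k] M) (a b : Fin (i + 2)) : M :=
  if h : ∃ σ : Equiv.Perm (Fin (i + 2)), σ 0 = a ∧ σ 1 = b then complementValue f h.choose else 0

theorem dualMatrix_apply (f : (Fin (i + 2) → k) [⋀^Fin i]→ₗ[k] M)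
    (σ : Equiv.Perm (Fin (i + 2))) : dualMatrix f (σ 0) (σ 1) = complementValue f σ := by
  have h : ∃ τ : Equiv.Perm (Fin (i + 2)), τ 0 = σ 0 ∧ τ 1 = σ 1 := ⟨σ, rfl, rfl⟩
  rw [dualMatrix, dif_pos h]
  exact complementValue_eq f h.choose_spec.1 h.choose_spec.2

theorem dualMatrix_self (f : (Fin (i + 2) → k) [⋀^Fin i]→ₗ[k] M) (a : Fin (i + 2)) :
    dualMatrix f a a = 0 := by
  rw [dualMatrix, dif_neg]
  rintro ⟨σ, h₀, h₁⟩
  exact zero_ne_one (σ.injective (h₀.trans h₁.symm))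

theorem exists_perm_of_ne {m : ℕ} {a b : Fin (m + 2)} (h : a ≠ b) :
    ∃ σ : Equiv.Perm (Fin (m + 2)), σ 0 = a ∧ σ 1 = b := by
  refine ⟨Equiv.swap (Equiv.swap 0 a 1) b * Equiv.swap 0 a, ?_, ?_⟩
  · rw [Equiv.Perm.mul_apply, Equiv.swap_apply_left]
    refine Equiv.swap_apply_of_ne_of_ne (fun hh => ?_) h
    have := (Equiv.swap 0 a).injective ((Equiv.swap_apply_left 0 a).trans hh)
    exact zero_ne_one this
  · rw [Equiv.Perm.mul_apply, Equiv.swap_apply_left]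

theorem dualMatrix_swap (f : (Fin (i + 2) → k) [⋀^Fin i]→ₗ[k] M) (a b : Fin (i + 2)) :
    dualMatrix f b a = -dualMatrix f a b := by
  by_cases h : a = b
  · subst h
    rw [dualMatrix_self, neg_zero]
  obtain ⟨σ, rfl, rfl⟩ := exists_perm_of_ne h
  have := dualMatrix_apply f (σ * Equiv.swap 0 1)
  simp only [Equiv.Perm.mul_apply, Equiv.swap_apply_left, Equiv.swap_apply_right] at this
  rw [this, dualMatrix_apply, complementValue, complementValue, Equiv.Perm.sign_mul,
    Equiv.Perm.sign_swap zero_ne_one]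
  have hs : ∀ r : Fin i, (Equiv.swap (0 : Fin (i + 2)) 1) r.succ.succ = r.succ.succ := fun r =>
    Equiv.swap_apply_of_ne_of_ne (Fin.succ_ne_zero _)
      (fun hh => Fin.succ_ne_zero r (Fin.succ_injective _ hh))
  simp [hs]

theorem dualMatrix_mem {f : (Fin (i + 2) → k) [⋀^Fin i]→ₗ[k] M} {p : Submodule k M}
    (hf : ∀ ω, f ω ∈ p) (a b : Fin (i + 2)) : dualMatrix f a b ∈ p := by
  rw [dualMatrix]
  split_ifs
  · rw [complementValue]
    exact zsmul_mem (hf _) _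
  · exact p.zero_mem

theorem eq_zero_of_dualMatrix_eq_zero {f : (Fin (i + 2) → k) [⋀^Fin i]→ₗ[k] M}
    (h : ∀ a b, dualMatrix f a b = 0) : f = 0 := by
  refine (Pi.basisFun k (Fin (i + 2))).ext_alternating fun v hv => ?_
  -- complete the injection `v` to a permutation whose first two values are those missed by `v`
  obtain ⟨σ, hσ⟩ : ∃ σ : Equiv.Perm (Fin (i + 2)), ∀ r : Fin i, σ r.succ.succ = v r := by
    have hinj : Function.Injective fun r : Fin i => r.succ.succ :=
      (Fin.succ_injective _).comp (Fin.succ_injective _)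
    let e := (Equiv.ofInjective _ hinj).symm.trans (Equiv.ofInjective v hv)
    refine ⟨e.extendSubtype, fun r => ?_⟩
    rw [Equiv.extendSubtype_apply_of_mem _ _ ⟨r, rfl⟩]
    have : (⟨r.succ.succ, ⟨r, rfl⟩⟩ : Set.range fun r : Fin i => r.succ.succ) =
        Equiv.ofInjective _ hinj r := rfl
    simp only [e, Equiv.trans_apply]
    erw [this]
    simp
  have h1 := h (σ 0) (σ 1)
  rw [dualMatrix_apply, complementValue] at h1
  simp only [Pi.basisFun_apply, AlternatingMap.zero_apply]
  simp only [hσ] at h1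
  rcases Int.units_eq_one_or (Equiv.Perm.sign σ) with h | h <;> simpa [h] using h1

end Star

section StarRelation

variable {k A : Type*} [Field k] [CommRing A] [Algebra k A] {i : ℕ}

theorem fin_zero_ne_two {m : ℕ} : (0 : Fin (m + 3)) ≠ 2 := by
  rw [← Fin.succ_one_eq_two]
  exact (Fin.succ_ne_zero _).symm

theorem fin_one_ne_two {m : ℕ} : (1 : Fin (m + 3)) ≠ 2 := by
  rw [← Fin.succ_one_eq_two, ← Fin.succ_zero_eq_one]
  exact fun h => zero_ne_one (Fin.succ_injective _ h)

theorem exists_perm_of_ne₃ {m : ℕ} {a b c : Fin (m + 3)} (hab : a ≠ b) (hac : a ≠ c)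
    (hbc : b ≠ c) : ∃ σ : Equiv.Perm (Fin (m + 3)), σ 0 = a ∧ σ 1 = b ∧ σ 2 = c := by
  obtain ⟨σ, rfl, rfl⟩ := exists_perm_of_ne hab
  refine ⟨Equiv.swap (σ 2) c * σ, ?_, ?_, ?_⟩
  · exact Equiv.swap_apply_of_ne_of_ne (fun h => fin_zero_ne_two (σ.injective h)) hac
  · exact Equiv.swap_apply_of_ne_of_ne (fun h => fin_one_ne_two (σ.injective h)) hbc
  · exact Equiv.swap_apply_left _ _

/-- The Koszul relation for an alternating form becomes a three-term relation for the dual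
skew-symmetric matrix. -/
theorem dualMatrix_relation (l : Fin (i + 3) → A)
    (f : (Fin (i + 3) → k) [⋀^Fin (i + 1)]→ₗ[k] A)
    (hrel : ∀ ω : Fin i → Fin (i + 3) → k, ∑ j, l j * f (Fin.cons (Pi.single j 1) ω) = 0)
    (a b c : Fin (i + 3)) :
    l a * dualMatrix f b c - l b * dualMatrix f a c + l c * dualMatrix f a b = 0 := by
  by_cases hab : a = b
  · subst hab; simp [dualMatrix_self]
  by_cases hbc : b = c
  · subst hbc; simp [dualMatrix_self]
  by_cases hac : a = c
  · subst hac
    rw [dualMatrix_swap f a b, dualMatrix_self]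
    ring
  obtain ⟨σ, rfl, rfl, rfl⟩ := exists_perm_of_ne₃ hab hac hbc
  have hsum := hrel fun r => Pi.single (σ r.succ.succ.succ) 1
  rw [← Equiv.sum_comp σ, Fin.sum_univ_succ, Fin.sum_univ_succ, Fin.sum_univ_succ,
    Finset.sum_eq_zero (s := Finset.univ) (f := fun r : Fin i => _)] at hsum
  swap
  · intro r _
    rw [f.map_eq_zero_of_eq _ (i := 0) (j := r.succ) (by simp) (Fin.succ_ne_zero r).symm, mul_zero]
  simp only [Fin.succ_zero_eq_one, Fin.succ_one_eq_two, add_zero] at hsum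
  -- the three remaining terms are entries of the dual matrix, up to signs
  have key : ∀ τ : Equiv.Perm (Fin (i + 3)), (∀ r : Fin i, τ r.succ.succ.succ = r.succ.succ.succ) →
      f (Fin.cons (Pi.single (σ (τ 2)) 1) fun r => Pi.single (σ r.succ.succ.succ) 1) =
        (Equiv.Perm.sign σ * Equiv.Perm.sign τ : ℤ) • dualMatrix f (σ (τ 0)) (σ (τ 1)) := by
    intro τ hτ
    have h := dualMatrix_apply f (σ * τ)
    simp only [Equiv.Perm.mul_apply] at h
    rw [h, complementValue, Equiv.Perm.sign_mul, smul_smul]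
    have hfun : (fun r : Fin (i + 1) => (Pi.single ((σ * τ) r.succ.succ) 1 : Fin (i + 3) → k)) =
        Fin.cons (Pi.single (σ (τ 2)) 1) fun r => Pi.single (σ r.succ.succ.succ) 1 := by
      funext r
      induction r using Fin.cases with
      | zero => simp
      | succ r => simp [hτ]
    rw [hfun]
    rcases Int.units_eq_one_or (Equiv.Perm.sign σ) with h | h <;>
      rcases Int.units_eq_one_or (Equiv.Perm.sign τ) with h' | h' <;> simp [h, h']
  have hne : ∀ r : Fin i, r.succ.succ.succ ≠ (0 : Fin (i + 3)) ∧
      r.succ.succ.succ ≠ (1 : Fin (i + 3)) ∧ r.succ.succ.succ ≠ (2 : Fin (i + 3)) := fun r => by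
    rw [← Fin.succ_one_eq_two, ← Fin.succ_zero_eq_one]
    refine ⟨Fin.succ_ne_zero _, fun h => ?_, fun h => ?_⟩
    · exact Fin.succ_ne_zero _ (Fin.succ_injective _ h)
    · exact Fin.succ_ne_zero _ (Fin.succ_injective _ (Fin.succ_injective _ h))
  have h01 : (0 : Fin (i + 3)) ≠ 1 := zero_ne_one
  have h02 : (0 : Fin (i + 3)) ≠ 2 := fin_zero_ne_two
  have h12 : (1 : Fin (i + 3)) ≠ 2 := fin_one_ne_two
  have k2 := key 1 fun r => rfl
  have k1 := key (Equiv.swap 1 2) fun r => Equiv.swap_apply_of_ne_of_ne (hne r).2.1 (hne r).2.2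
  have k0 := key (Equiv.swap 0 2) fun r => Equiv.swap_apply_of_ne_of_ne (hne r).1 (hne r).2.2
  rw [Equiv.swap_apply_right, Equiv.swap_apply_left, Equiv.swap_apply_of_ne_of_ne h01 h02,
    Equiv.Perm.sign_swap h12] at k1
  rw [Equiv.swap_apply_right, Equiv.swap_apply_left, Equiv.swap_apply_of_ne_of_ne h01.symm h12,
    Equiv.Perm.sign_swap h02, dualMatrix_swap] at k0
  simp only [Equiv.Perm.one_apply, Equiv.Perm.sign_one] at k2
  rw [k0, k1, k2] at hsum
  rcases Int.units_eq_one_or (Equiv.Perm.sign σ) with h | h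
  · simp only [h] at hsum
    push_cast at hsum
    linear_combination (exp := 1) hsum
  · simp only [h] at hsum
    push_cast at hsum
    linear_combination (exp := 1) -hsum

end StarRelation

/-! ### The linear strand of a minimal resolution -/

namespace MinimalFreeResolution

variable {k : Type*} [Field k] {n : ℕ} {I : Ideal (CoordRing k n)}
  (F : MinimalFreeResolution I)

theorem constantCoeff_diff (i : ℕ) (x : Fin (F.rk (i + 1)) → CoordRing k n)
    (a : Fin (F.rk i)) : MvPolynomial.constantCoeff (F.diff i x a) = 0 := by
  have hx : x = ∑ b, x b • (Pi.single b 1 : Fin (F.rk (i + 1)) → CoordRing k n) := by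
    ext1 c
    simp [Finset.sum_apply, Pi.single_apply]
  rw [hx, map_sum, Finset.sum_apply, map_sum]
  refine Finset.sum_eq_zero fun b _ => ?_
  rw [map_smul, Pi.smul_apply, smul_eq_mul, map_mul, F.minimal, mul_zero]

theorem aug_mem (x : Fin (F.rk 0) → CoordRing k n) : F.aug x ∈ I :=
  F.range_aug.le (LinearMap.mem_range_self _ _)

theorem single_notMem_range_diff (i : ℕ) (b : Fin (F.rk i)) :
    (Pi.single b 1 : Fin (F.rk i) → CoordRing k n) ∉ LinearMap.range (F.diff i) := by
  rintro ⟨x, hx⟩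
  have := F.constantCoeff_diff i x b
  rw [hx] at this
  simp at this

/-- If the ideal contains no forms of degree less than two, then the `i`-th term of the
resolution is generated in degrees at least `i + 2`. -/
theorem le_deg (hI : ∀ f ∈ I, ∀ m < 2, f.IsHomogeneous m → f = 0) (i : ℕ) (b : Fin (F.rk i)) :
    i + 2 ≤ F.deg i b := by
  induction i with
  | zero =>
    by_contra! hlt
    refine F.single_notMem_range_diff 0 b ((F.exact_zero _).1 ?_)
    exact hI _ (F.aug_mem _) _ (by omega) (F.aug_homogeneous b)
  | succ i ih =>
    have hne : F.diff i (Pi.single b 1) ≠ 0 := fun h =>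
      F.single_notMem_range_diff (i + 1) b ((F.exact_succ i _).1 h)
    obtain ⟨a, ha⟩ := Function.ne_iff.1 hne
    obtain ⟨e, he, hhom⟩ := (F.diff_homogeneous i b a).resolve_left ha
    have he0 : e ≠ 0 := by
      rintro rfl
      have h1 := F.minimal i b a
      rw [← MvPolynomial.totalDegree_zero_iff_isHomogeneous,
        MvPolynomial.totalDegree_eq_zero_iff_eq_C] at hhom
      rw [hhom, MvPolynomial.constantCoeff_C] at h1
      rw [hhom, h1, map_zero] at ha
      exact ha rfl
    have := ih a
    omega

/-- The inclusion of `V_p` in `F_p` as a linear map. -/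
def toFreeₗ (p : ℕ) : F.LinearSyzygy p →ₗ[k] (Fin (F.rk p) → CoordRing k n) where
  toFun := F.toFree
  map_add' s t := by
    simp only [toFree, Pi.add_apply, map_add, Pi.single_add, Finset.sum_add_distrib]
  map_smul' c s := by
    simp only [toFree, Pi.smul_apply, smul_eq_mul, map_mul, RingHom.id_apply, Finset.smul_sum]
    refine Finset.sum_congr rfl fun b _ => ?_
    rw [← Pi.single_smul, MvPolynomial.smul_eq_C_mul]

theorem toFree_eq_sum {p : ℕ} (s : F.LinearSyzygy p) :
    F.toFree s = ∑ b : {b : Fin (F.rk p) // F.deg p b = p + 2},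
      (MvPolynomial.C (s b) : CoordRing k n) • (Pi.single b.1 1 : Fin (F.rk p) → CoordRing k n) := by
  rw [toFree]
  refine Finset.sum_congr rfl fun b _ => ?_
  rw [← Pi.single_smul, smul_eq_mul, mul_one]

theorem toFree_apply_of_deg_eq {p : ℕ} (s : F.LinearSyzygy p)
    (a : {b : Fin (F.rk p) // F.deg p b = p + 2}) :
    F.toFree s a.1 = MvPolynomial.C (s a) := by
  rw [toFree, Finset.sum_apply, Finset.sum_eq_single a]
  · simp
  · intro b _ hb
    rw [Pi.single_eq_of_ne]
    exact fun h => hb (Subtype.ext h.symm)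
  · simp

theorem toFree_apply_of_deg_ne {p : ℕ} (s : F.LinearSyzygy p) {a : Fin (F.rk p)}
    (ha : F.deg p a ≠ p + 2) : F.toFree s a = 0 := by
  rw [toFree, Finset.sum_apply]
  refine Finset.sum_eq_zero fun b _ => Pi.single_eq_of_ne ?_ _
  rintro rfl
  exact ha b.2

theorem eq_zero_of_toFree_mem_range {p : ℕ} {s : F.LinearSyzygy p}
    (h : F.toFree s ∈ LinearMap.range (F.diff p)) : s = 0 := by
  obtain ⟨x, hx⟩ := h
  funext a
  have := F.constantCoeff_diff p x a.1
  rwa [hx, toFree_apply_of_deg_eq, MvPolynomial.constantCoeff_C] at this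

theorem diff_toFree_isHomogeneous {q : ℕ} (s : F.LinearSyzygy (q + 1)) {a : Fin (F.rk q)}
    (ha : F.deg q a = q + 2) : (F.diff q (F.toFree s) a).IsHomogeneous 1 := by
  rw [toFree_eq_sum, map_sum, Finset.sum_apply]
  refine MvPolynomial.IsHomogeneous.sum _ _ _ fun b _ => ?_
  rw [map_smul, Pi.smul_apply, smul_eq_mul]
  refine MvPolynomial.IsHomogeneous.C_mul ?_ _
  rcases F.diff_homogeneous q b.1 a with h | ⟨e, he, hhom⟩
  · rw [h]; exact MvPolynomial.isHomogeneous_zero _ _ _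
  · rwa [show e = 1 by rw [ha, b.2] at he; omega] at hhom

theorem diff_toFree_eq_zero (hI : ∀ f ∈ I, ∀ m < 2, f.IsHomogeneous m → f = 0) {q : ℕ}
    (s : F.LinearSyzygy (q + 1)) {a : Fin (F.rk q)} (ha : F.deg q a ≠ q + 2) :
    F.diff q (F.toFree s) a = 0 := by
  rw [toFree_eq_sum, map_sum, Finset.sum_apply]
  refine Finset.sum_eq_zero fun b _ => ?_
  rw [map_smul, Pi.smul_apply]
  rcases F.diff_homogeneous q b.1 a with h | ⟨e, he, hhom⟩
  · rw [h, smul_zero]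
  · -- the entry would be a constant
    have hdeg := F.le_deg hI q a
    rw [b.2] at he
    obtain rfl : e = 0 := by omega
    have h1 := F.minimal q b.1 a
    rw [← MvPolynomial.totalDegree_zero_iff_isHomogeneous,
      MvPolynomial.totalDegree_eq_zero_iff_eq_C] at hhom
    rw [hhom, MvPolynomial.constantCoeff_C] at h1
    rw [hhom, h1, map_zero, smul_zero]

theorem aug_toFree_isHomogeneous (s : F.LinearSyzygy 0) :
    (F.aug (F.toFree s)).IsHomogeneous 2 := by
  rw [toFree_eq_sum, map_sum]
  refine MvPolynomial.IsHomogeneous.sum _ _ _ fun b _ => ?_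
  rw [map_smul, smul_eq_mul]
  refine MvPolynomial.IsHomogeneous.C_mul ?_ _
  have := F.aug_homogeneous b.1
  rwa [b.2] at this

variable {F} {g : ℕ} {l : Fin g → CoordRing k n}

/-- If the entries of `diff (toFree s)` are combinations of the forms `l j` with coefficients
`c j a`, then `diff (toFree s)` is `∑ j, l j • toFree (c j)`. -/
theorem diff_toFree_eq_sum (hI : ∀ f ∈ I, ∀ m < 2, f.IsHomogeneous m → f = 0) {q : ℕ}
    {s : F.LinearSyzygy (q + 1)} {c : Fin g → F.LinearSyzygy q}
    (h : ∀ a : {a : Fin (F.rk q) // F.deg q a = q + 2},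
      F.diff q (F.toFree s) a.1 = ∑ j, c j a • l j) :
    F.diff q (F.toFree s) = ∑ j, l j • F.toFree (c j) := by
  ext1 a
  rw [Finset.sum_apply]
  by_cases ha : F.deg q a = q + 2
  · refine (h ⟨a, ha⟩).trans (Finset.sum_congr rfl fun j _ => ?_)
    rw [Pi.smul_apply, F.toFree_apply_of_deg_eq (c j) ⟨a, ha⟩, smul_eq_mul,
      MvPolynomial.smul_eq_C_mul, mul_comm]
  · rw [F.diff_toFree_eq_zero hI s ha]
    simp [F.toFree_apply_of_deg_ne (c _) ha]

/-- One step of the comparison of the Koszul complex of the forms `l j` with the linear strand: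
an alternating form with values in `V_{r+1}`, compatible with the differentials, lifts to an
alternating form with values in `V_r`. -/
theorem exists_koszul_lift [Infinite k] (hI : ∀ f ∈ I, ∀ m < 2, f.IsHomogeneous m → f = 0)
    (hl : ∀ j, (l j).IsHomogeneous 1) (hli : LinearIndependent k l) {r i : ℕ}
    (ψ : (Fin g → k) [⋀^Fin (i + 1)]→ₗ[k] F.LinearSyzygy (r + 1)) (hne : ψ ≠ 0)
    (hψ : ∀ ω : Fin i → Fin g → k, ∑ j, l j • F.toFree (ψ (Fin.cons (Pi.single j 1) ω)) ∈
      LinearMap.range (F.diff (r + 1))) :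
    ∃ ψ' : (Fin g → k) [⋀^Fin (i + 1 + 1)]→ₗ[k] F.LinearSyzygy r, ψ' ≠ 0 ∧
      ∀ ω : Fin (i + 1) → Fin g → k, ∑ j, l j • F.toFree (ψ' (Fin.cons (Pi.single j 1) ω)) ∈
        LinearMap.range (F.diff r) := by
  let f : {a : Fin (F.rk r) // F.deg r a = r + 2} →
      (Fin g → k) [⋀^Fin (i + 1)]→ₗ[k] CoordRing k n := fun a =>
    (LinearMap.proj a.1 ∘ₗ (F.diff r).restrictScalars k ∘ₗ F.toFreeₗ (r + 1)).compAlternatingMap ψ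
  have hf : ∀ a ω, f a ω = F.diff r (F.toFree (ψ ω)) a.1 := fun a ω => rfl
  have hrel : ∀ a (ω : Fin i → Fin g → k),
      ∑ j, l j * f a (Fin.cons (Pi.single j 1) ω) = 0 := fun a ω => by
    have := congrFun ((F.exact_succ r _).2 (hψ ω)) a.1
    simpa only [map_sum, Finset.sum_apply, map_smul, Pi.smul_apply, smul_eq_mul, hf,
      Pi.zero_apply] using this
  choose h hh using fun a => exists_alternating_of_koszul_relation hl hli (f a)
    (fun ω => F.diff_toFree_isHomogeneous (ψ ω) a.2) (hrel a)
  have hlift : ∀ ω, F.diff r (F.toFree (ψ ω)) =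
      ∑ j, l j • F.toFree (AlternatingMap.pi h (Fin.cons (Pi.single j 1) ω)) := fun ω =>
    diff_toFree_eq_sum hI fun a => hh a ω
  refine ⟨AlternatingMap.pi h, fun h0 => hne ?_, fun ω => ⟨_, hlift ω⟩⟩
  -- the differential is injective on `V_{r+1}` by minimality
  ext1 ω
  refine F.eq_zero_of_toFree_mem_range ((F.exact_succ r _).1 ?_)
  rw [hlift, h0]
  refine Finset.sum_eq_zero fun j _ => ?_
  rw [AlternatingMap.zero_apply, show F.toFree (0 : F.LinearSyzygy r) = 0 from
    map_zero (F.toFreeₗ r), smul_zero]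

/-- A syzygy of rank `q + 3` in the `(q + 1)`-st step of the linear strand comes from a
`2 × (q + 3)` matrix of linear forms, with independent entries in one row, whose minors lie in
the ideal and do not all vanish. -/
theorem exists_matrix_of_syzygyRank_eq [Infinite k]
    (hI : ∀ f ∈ I, ∀ m < 2, f.IsHomogeneous m → f = 0) {q : ℕ} (s : F.LinearSyzygy (q + 1))
    (hs : F.syzygyRank s = q + 3) :
    ∃ l a : Fin (q + 3) → CoordRing k n, (∀ j, (l j).IsHomogeneous 1) ∧ LinearIndependent k l ∧
      (∀ j, (a j).IsHomogeneous 1) ∧ (∀ i j, a i * l j - a j * l i ∈ I) ∧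
      ∃ i j, a i * l j - a j * l i ≠ 0 := by
  have hfin : FiniteDimensional k (F.involvedForms s) :=
    Module.finite_of_finrank_pos (by rw [syzygyRank] at hs; omega)
  let b : Module.Basis (Fin (q + 3)) k (F.involvedForms s) := Module.finBasisOfFinrankEq _ _ hs
  let l : Fin (q + 3) → CoordRing k n := fun j => b j
  have hmem : ∀ a : {a : Fin (F.rk q) // F.deg q a = q + 2},
      F.diff q (F.toFree s) a.1 ∈ F.involvedForms s := fun a =>
    Submodule.subset_span ⟨a, rfl⟩
  have hle : F.involvedForms s ≤ MvPolynomial.homogeneousSubmodule (Fin (n + 1)) k 1 := by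
    refine Submodule.span_le.2 ?_
    rintro _ ⟨a, rfl⟩
    exact F.diff_toFree_isHomogeneous s a.2
  have hl : ∀ j, (l j).IsHomogeneous 1 := fun j => hle (b j).2
  have hli : LinearIndependent k l :=
    b.linearIndependent.map' (F.involvedForms s).subtype (by simp)
  let c : Fin (q + 3) → F.LinearSyzygy q := fun j a => b.repr ⟨_, hmem a⟩ j
  have hc : ∀ a : {a : Fin (F.rk q) // F.deg q a = q + 2},
      F.diff q (F.toFree s) a.1 = ∑ j, c j a • l j := fun a => by
    have := congrArg (F.involvedForms s).subtype (b.sum_repr ⟨_, hmem a⟩)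
    rw [map_sum] at this
    exact this.symm
  have hlift := diff_toFree_eq_sum hI hc
  -- the alternating forms `ψ` descend along the linear strand
  have hdescend : ∀ i r : ℕ, r + i = q →
      ∃ ψ : (Fin (q + 3) → k) [⋀^Fin (i + 1)]→ₗ[k] F.LinearSyzygy r, ψ ≠ 0 ∧
        ∀ ω : Fin i → Fin (q + 3) → k, ∑ j, l j • F.toFree (ψ (Fin.cons (Pi.single j 1) ω)) ∈
          LinearMap.range (F.diff r) := by
    intro i
    induction i with
    | zero =>
      intro r hr
      obtain rfl : q = r := hr.symm
      let ψ : (Fin (q + 3) → k) [⋀^Fin 1]→ₗ[k] F.LinearSyzygy q :=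
        AlternatingMap.ofSubsingleton k _ _ (0 : Fin 1) (Fintype.linearCombination k c)
      have hψ : ∀ ω j, ψ (Fin.cons (Pi.single j 1) ω) = c j := fun ω j => by
        simp [ψ, Fintype.linearCombination_apply_single]
      refine ⟨ψ, fun h0 => ?_, fun ω => ⟨F.toFree s, ?_⟩⟩
      · have hbot : F.involvedForms s = ⊥ := by
          refine Submodule.span_eq_bot.2 ?_
          rintro _ ⟨a, rfl⟩
          refine (hc a).trans ?_
          refine Finset.sum_eq_zero fun j _ => ?_
          rw [← hψ 0 j, h0]
          simp
        rw [syzygyRank, hbot, finrank_bot] at hs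
        omega
      · simp only [hψ]
        exact hlift
    | succ i ih =>
      intro r hr
      obtain ⟨ψ, hne, hψ⟩ := ih (r + 1) (by omega)
      exact exists_koszul_lift hI hl hli ψ hne hψ
  obtain ⟨ψ, hne, hψ⟩ := hdescend q 0 (zero_add q)
  let f : (Fin (q + 3) → k) [⋀^Fin (q + 1)]→ₗ[k] CoordRing k n :=
    (F.aug.restrictScalars k ∘ₗ F.toFreeₗ 0).compAlternatingMap ψ
  have hf : ∀ ω, f ω = F.aug (F.toFree (ψ ω)) := fun ω => rfl
  have hf0 : f ≠ 0 := fun h0 => hne <| by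
    ext1 ω
    exact F.eq_zero_of_toFree_mem_range ((F.exact_zero _).1 (by rw [← hf, h0]; rfl))
  have hrel : ∀ ω : Fin q → Fin (q + 3) → k,
      ∑ j, l j * f (Fin.cons (Pi.single j 1) ω) = 0 := fun ω => by
    have := (F.exact_zero _).2 (hψ ω)
    simpa only [map_sum, map_smul, smul_eq_mul, hf] using this
  obtain ⟨a, ha, hQ⟩ := exists_minors_of_koszul_relation hl hli
    (dualMatrix_mem (p := MvPolynomial.homogeneousSubmodule _ k 2) fun ω =>
      F.aug_toFree_isHomogeneous (ψ ω))
    (dualMatrix_relation l f hrel) zero_ne_one fin_zero_ne_two fin_one_ne_two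
  refine ⟨l, a, hl, hli, ha, fun i j => ?_, ?_⟩
  · rw [← hQ]
    refine dualMatrix_mem (p := I.restrictScalars k) (fun ω => ?_) i j
    exact F.aug_mem _
  · by_contra! h0
    exact hf0 (eq_zero_of_dualMatrix_eq_zero fun i j => (hQ i j).trans (h0 i j))

end MinimalFreeResolution

/-! ### Counting the monomials on a scroll -/

section Exponents

variable {d : ℕ} (a : Fin d → ℕ)

/-- The exponents of the monomials `∏ cᵢ ^ αᵢ * w ^ γ` with `∑ αᵢ = m` and `γ ≤ ∑ aᵢ αᵢ`, where
`cᵢ` is the variable `some i` and `w` the variable `none`. -/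
def scrollExponents (m : ℕ) : Finset (Option (Fin d) →₀ ℕ) :=
  (((Finset.univ : Finset (Fin d)).finsuppAntidiag m).sigma
    fun α => Finset.range (∑ i, a i * α i + 1)).image fun p => p.1.optionElim p.2

theorem mem_scrollExponents {m : ℕ} {η : Option (Fin d) →₀ ℕ} :
    η ∈ scrollExponents a m ↔
      ∑ i, η (some i) = m ∧ η none ≤ ∑ i, a i * η (some i) := by
  simp only [scrollExponents, Finset.mem_image, Finset.mem_sigma, Finset.mem_finsuppAntidiag,
    Finset.mem_range, Nat.lt_succ_iff, Finset.subset_univ, and_true]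
  constructor
  · rintro ⟨⟨α, γ⟩, ⟨h1, h2⟩, rfl⟩
    simpa using ⟨h1, h2⟩
  · rintro ⟨h1, h2⟩
    exact ⟨⟨η.some, η none⟩, ⟨h1, by simpa using h2⟩, η.optionElim_some⟩

theorem card_scrollExponents (m : ℕ) :
    (scrollExponents a m).card =
      ∑ α ∈ (Finset.univ : Finset (Fin d)).finsuppAntidiag m, (∑ i, a i * α i + 1) := by
  rw [scrollExponents, Finset.card_image_of_injective, Finset.card_sigma]
  · simp
  · rintro ⟨α, γ⟩ ⟨α', γ'⟩ h
    have h1 := congrArg Finsupp.some h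
    have h2 := DFunLike.congr_fun h none
    simp only [Finsupp.some_optionElim, Finsupp.optionElim_apply_none] at h1 h2
    rw [h1, h2]

theorem sum_finsuppAntidiag_apply (m : ℕ) (i j : Fin d) :
    ∑ α ∈ (Finset.univ : Finset (Fin d)).finsuppAntidiag m, α i =
      ∑ α ∈ (Finset.univ : Finset (Fin d)).finsuppAntidiag m, α j := by
  have hmem : ∀ α ∈ (Finset.univ : Finset (Fin d)).finsuppAntidiag m,
      Finsupp.equivMapDomain (Equiv.swap i j) α ∈
        (Finset.univ : Finset (Fin d)).finsuppAntidiag m := fun α hα => by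
    simp only [Finset.mem_finsuppAntidiag, Finset.subset_univ, and_true,
      Finsupp.equivMapDomain_apply] at hα ⊢
    rw [← hα]
    exact Equiv.sum_comp _ α
  refine Finset.sum_nbij' (Finsupp.equivMapDomain (Equiv.swap i j))
    (Finsupp.equivMapDomain (Equiv.swap i j)) hmem hmem ?_ ?_ ?_
  · intro α _; ext; simp
  · intro α _; ext; simp
  · intro α _; simp

/-- By symmetry the average of the `i`-th exponent over all monomials of degree `m` in `d`
variables is `m / d`. -/
theorem mul_sum_finsuppAntidiag_apply (m : ℕ) (i : Fin d) :
    d * ∑ α ∈ (Finset.univ : Finset (Fin d)).finsuppAntidiag m, α i =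
      m * ((Finset.univ : Finset (Fin d)).finsuppAntidiag m).card := by
  calc d * ∑ α ∈ (Finset.univ : Finset (Fin d)).finsuppAntidiag m, α i
      = ∑ _j : Fin d, ∑ α ∈ (Finset.univ : Finset (Fin d)).finsuppAntidiag m, α i := by simp
    _ = ∑ j, ∑ α ∈ (Finset.univ : Finset (Fin d)).finsuppAntidiag m, α j :=
        Finset.sum_congr rfl fun j _ => sum_finsuppAntidiag_apply m i j
    _ = ∑ α ∈ (Finset.univ : Finset (Fin d)).finsuppAntidiag m, m := by
        rw [Finset.sum_comm]
        exact Finset.sum_congr rfl fun α hα => (Finset.mem_finsuppAntidiag.1 hα).1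
    _ = _ := by rw [Finset.sum_const, smul_eq_mul, mul_comm]

/-- The Hilbert polynomial of the scroll `S(a₁, …, a_d)` with `d = e + 1`, namely
`(1 + (∑ aᵢ) m / d) * (m + e choose e)`. -/
def scrollPolynomial {e : ℕ} (a : Fin (e + 1) → ℕ) : Polynomial ℚ :=
  (1 + Polynomial.C ((∑ i, a i : ℕ) / (e + 1 : ℚ)) * Polynomial.X) *
    Polynomial.preHilbertPoly ℚ e 0

theorem card_scrollExponents_eq_eval {e : ℕ} (a : Fin (e + 1) → ℕ) (m : ℕ) :
    ((scrollExponents a m).card : ℚ) = (scrollPolynomial a).eval (m : ℚ) := by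
  have hcard : ((Finset.univ : Finset (Fin (e + 1))).finsuppAntidiag m).card =
      (m + e).choose e := by
    rw [Finset.card_finsuppAntidiag_nat_eq_choose, Finset.card_univ, Fintype.card_fin,
      show e + 1 + m - 1 = m + e by omega, Nat.choose_symm_add]
  have hne : (e + 1 : ℚ) ≠ 0 := by positivity
  have hi : ∀ i : Fin (e + 1),
      ((∑ α ∈ (Finset.univ : Finset (Fin (e + 1))).finsuppAntidiag m, α i : ℕ) : ℚ) =
        m * (m + e).choose e / (e + 1) := fun i => by
    have := mul_sum_finsuppAntidiag_apply m i
    rw [hcard] at this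
    rw [eq_div_iff hne, mul_comm]
    exact_mod_cast this
  have hsum : (scrollExponents a m).card =
      ∑ i, a i * ∑ α ∈ (Finset.univ : Finset (Fin (e + 1))).finsuppAntidiag m, α i +
        (m + e).choose e := by
    rw [card_scrollExponents, Finset.sum_add_distrib, Finset.sum_comm, ← hcard]
    simp [Finset.mul_sum]
  have heval := Polynomial.preHilbertPoly_eq_choose_sub_add ℚ e (Nat.zero_le m)
  rw [Nat.sub_zero] at heval
  rw [hsum, scrollPolynomial, Polynomial.eval_mul, heval, Nat.cast_add, Nat.cast_sum]
  simp only [Nat.cast_mul, hi, ← Finset.sum_mul, Polynomial.eval_add, Polynomial.eval_one,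
    Polynomial.eval_mul, Polynomial.eval_C, Polynomial.eval_X, Nat.cast_sum]
  field_simp
  ring

theorem natDegree_linear_factor {c : ℚ} (hc : c ≠ 0) :
    (1 + Polynomial.C c * Polynomial.X).natDegree = 1 := by
  rw [add_comm, ← Polynomial.C_1]
  exact Polynomial.natDegree_linear hc

theorem scrollPolynomial_natDegree_leadingCoeff {e : ℕ} {a : Fin (e + 1) → ℕ} (ha : ∃ i, 0 < a i) :
    scrollPolynomial a ≠ 0 ∧ (scrollPolynomial a).natDegree = e + 1 ∧
      (scrollPolynomial a).leadingCoeff * ((e + 1).factorial : ℚ) = (∑ i, a i : ℕ) := by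
  obtain ⟨i, hi⟩ := ha
  have hpos : 0 < ∑ i, a i := Finset.sum_pos' (fun _ _ => Nat.zero_le _) ⟨i, Finset.mem_univ _, hi⟩
  have hc : ((∑ i, a i : ℕ) / (e + 1 : ℚ)) ≠ 0 := by positivity
  have hne : (1 + Polynomial.C ((∑ i, a i : ℕ) / (e + 1 : ℚ)) * Polynomial.X) ≠ 0 := by
    intro h
    have := natDegree_linear_factor hc
    rw [h] at this
    simp at this
  have hlead : (Polynomial.preHilbertPoly ℚ e 0).leadingCoeff ≠ 0 := by
    rw [Polynomial.leadingCoeff_preHilbertPoly]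
    positivity
  have hne' := Polynomial.leadingCoeff_ne_zero.1 hlead
  refine ⟨mul_ne_zero hne hne', ?_, ?_⟩
  · rw [scrollPolynomial, Polynomial.natDegree_mul hne hne', natDegree_linear_factor hc,
      Polynomial.natDegree_preHilbertPoly, add_comm]
  · rw [scrollPolynomial, Polynomial.leadingCoeff_mul, Polynomial.leadingCoeff_preHilbertPoly,
      Polynomial.leadingCoeff, natDegree_linear_factor hc, Nat.factorial_succ]
    have : (e.factorial : ℚ) ≠ 0 := by positivity
    simp [Polynomial.coeff_one]
    field_simp

/-- The exponent of the monomial obtained from `∏ x_{ij} ^ δ_{ij}` by the substitution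
`x_{ij} = cᵢ w ^ j`. -/
def substExponent (δ : (Σ i : Fin d, Fin (a i + 1)) →₀ ℕ) : Option (Fin d) →₀ ℕ :=
  ∑ p, δ p • (Finsupp.single (some p.1) 1 + Finsupp.single none (p.2 : ℕ))

theorem substExponent_some (δ : (Σ i : Fin d, Fin (a i + 1)) →₀ ℕ) (i : Fin d) :
    substExponent a δ (some i) = ∑ j, δ ⟨i, j⟩ := by
  simp [substExponent, Finsupp.finsetSum_apply, Fintype.sum_sigma, Finsupp.single_apply]

theorem substExponent_none (δ : (Σ i : Fin d, Fin (a i + 1)) →₀ ℕ) :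
    substExponent a δ none = ∑ i, ∑ j, δ ⟨i, j⟩ * (j : ℕ) := by
  simp [substExponent, Finsupp.finsetSum_apply, Fintype.sum_sigma]

theorem substExponent_add_single (δ : (Σ i : Fin d, Fin (a i + 1)) →₀ ℕ)
    (p : Σ i : Fin d, Fin (a i + 1)) :
    substExponent a (δ + Finsupp.single p 1) = substExponent a δ +
      (Finsupp.single (some p.1) 1 + Finsupp.single none (p.2 : ℕ)) := by
  simp only [substExponent, Finsupp.add_apply, add_smul, Finset.sum_add_distrib]
  congr 1
  rw [Finset.sum_eq_single p]
  · simp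
  · intro q _ hq
    rw [Finsupp.single_eq_of_ne (by simpa using hq), zero_smul]
  · simp

/-- The monomials that arise by the substitution `x_{ij} = cᵢ w ^ j` from the monomials of degree
`m` are exactly those with exponents in `scrollExponents a m`. -/
theorem image_substExponent (m : ℕ) :
    substExponent a '' {δ | δ.degree = m} = (scrollExponents a m : Set (Option (Fin d) →₀ ℕ)) := by
  ext η
  rw [Finset.mem_coe, mem_scrollExponents]
  constructor
  · rintro ⟨δ, rfl, rfl⟩
    rw [substExponent_none]
    simp only [substExponent_some]
    refine ⟨?_, Finset.sum_le_sum fun i _ => ?_⟩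
    · rw [Finsupp.degree_eq_sum, Fintype.sum_sigma]
    · rw [Finset.mul_sum]
      refine Finset.sum_le_sum fun j _ => ?_
      rw [mul_comm]
      exact Nat.mul_le_mul_right _ (Nat.lt_succ_iff.1 j.2)
  · induction m generalizing η with
    | zero =>
      rintro ⟨h1, h2⟩
      have h3 : ∀ i, η (some i) = 0 := by simpa using h1
      refine ⟨0, by simp, ?_⟩
      have h4 : η none = 0 := by simpa [h3] using h2
      ext o
      cases o with
      | none => simp [substExponent, h4]
      | some i => simp [substExponent, h3]
    | succ m ih =>
      rintro ⟨h1, h2⟩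
      obtain ⟨i, hi⟩ : ∃ i, 0 < η (some i) := by
        by_contra! h
        have : ∑ i, η (some i) = 0 := Finset.sum_eq_zero fun i _ => Nat.le_zero.1 (h i)
        omega
      -- split off a factor `cᵢ w ^ j` with `j` as small as possible
      let A := ∑ i, a i * η (some i) - a i
      have hiA : a i ≤ ∑ i, a i * η (some i) :=
        (Nat.le_mul_of_pos_right _ hi).trans
          (Finset.single_le_sum (f := fun i => a i * η (some i))
            (fun _ _ => Nat.zero_le _) (Finset.mem_univ i))
      let j := η none - A
      have hj : j ≤ a i := by omega
      let η' := η - (Finsupp.single (some i) 1 + Finsupp.single none j)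
      have hη' : η = η' + (Finsupp.single (some i) 1 + Finsupp.single none j) := by
        refine (tsub_add_cancel_of_le ?_).symm
        intro o
        cases o with
        | none => simp [j]
        | some i' =>
          by_cases h : i = i'
          · subst h; simpa using Nat.one_le_iff_ne_zero.2 hi.ne'
          · simp [h]
      have hs : ∀ i', η (some i') = η' (some i') + if i = i' then 1 else 0 := fun i' => by
        conv_lhs => rw [hη']
        simp [Finsupp.single_apply]
      have hn : η none = η' none + j := by
        conv_lhs => rw [hη']
        simp
      simp only [hs, Finset.sum_add_distrib, mul_add, Finset.sum_ite_eq, Finset.mem_univ, if_true,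
        mul_ite, mul_one, mul_zero] at h1 h2
      have hA : A = ∑ i, a i * η' (some i) := by
        simp only [A, hs, Finset.sum_add_distrib, mul_add, Finset.sum_ite_eq, Finset.mem_univ,
          if_true, mul_ite, mul_one, mul_zero]
        omega
      obtain ⟨δ, hδ, hδη⟩ := ih η' ⟨by omega, by omega⟩
      refine ⟨δ + Finsupp.single ⟨i, ⟨j, by omega⟩⟩ 1, ?_, ?_⟩
      · change δ.degree = m at hδ
        change Finsupp.degree _ = m + 1
        rw [map_add, hδ, Finsupp.degree_single]
      · rw [substExponent_add_single, hδη]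
        exact hη'.symm

end Exponents

/-! ### The Hilbert function of a scroll -/

section LinearChange

variable {k : Type*} [Field k] {σ τ : Type*} [Fintype σ] [DecidableEq σ]

/-- Composition of polynomials with a linear map `e`, as an algebra homomorphism. -/
def linearSubst (e : (σ → k) →ₗ[k] (τ → k)) : MvPolynomial τ k →ₐ[k] MvPolynomial σ k :=
  MvPolynomial.aeval fun t => ∑ s, MvPolynomial.C (e (Pi.single s 1) t) * MvPolynomial.X s

theorem eval_linearSubst (e : (σ → k) →ₗ[k] (τ → k)) (v : σ → k) (f : MvPolynomial τ k) :
    MvPolynomial.eval v (linearSubst e f) = MvPolynomial.eval (e v) f := by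
  induction f using MvPolynomial.induction_on with
  | C c => simp [linearSubst]
  | add f g hf hg => rw [map_add, map_add, hf, hg, map_add]
  | mul_X f t hf =>
    rw [map_mul, map_mul, hf, map_mul]
    congr 1
    have h := congrFun (LinearMap.pi_apply_eq_sum_univ e v) t
    have h2 : ∀ s : σ, (fun i => if s = i then (1 : k) else 0) = Pi.single s 1 := fun s => by
      ext i; simp [Pi.single_apply, eq_comm]
    simp only [h2] at h
    rw [MvPolynomial.eval_X, h]
    simp [linearSubst, mul_comm]

theorem linearSubst_isHomogeneous (e : (σ → k) →ₗ[k] (τ → k)) {f : MvPolynomial τ k} {m : ℕ}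
    (hf : f.IsHomogeneous m) : (linearSubst e f).IsHomogeneous m := by
  have := hf.aeval (fun t => ∑ s, MvPolynomial.C (e (Pi.single s 1) t) * MvPolynomial.X s)
    (n := 1) fun t => MvPolynomial.IsHomogeneous.sum _ _ _ fun s _ =>
      MvPolynomial.isHomogeneous_C_mul_X _ _
  rwa [one_mul] at this

theorem map_linearSubst_homogeneousSubmodule [Infinite k] [Fintype τ] [DecidableEq τ]
    (e : (σ → k) ≃ₗ[k] (τ → k)) (m : ℕ) :
    (MvPolynomial.homogeneousSubmodule τ k m).map (linearSubst e.toLinearMap).toLinearMap =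
      MvPolynomial.homogeneousSubmodule σ k m := by
  refine le_antisymm ?_ fun f hf => ?_
  · rintro _ ⟨f, hf, rfl⟩
    exact linearSubst_isHomogeneous _ hf
  · refine ⟨linearSubst e.symm.toLinearMap f, linearSubst_isHomogeneous _ hf, ?_⟩
    refine MvPolynomial.funext_iff.2 fun v => ?_
    change MvPolynomial.eval v (linearSubst _ (linearSubst _ f)) = _
    rw [eval_linearSubst, eval_linearSubst]
    simp

end LinearChange

section Parametrization

variable {k : Type*} [Field k] {d : ℕ} (a : Fin d → ℕ)

/-- The substitution `x_{ij} = cᵢ w ^ j`, which describes the part `u = 1` of the scroll. -/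
def scrollSubst :
    MvPolynomial (Σ i : Fin d, Fin (a i + 1)) k →ₐ[k] MvPolynomial (Option (Fin d)) k :=
  MvPolynomial.aeval fun p =>
    MvPolynomial.X (some p.1) * MvPolynomial.X none ^ (p.2 : ℕ)

theorem eval_scrollSubst (z : Option (Fin d) → k)
    (f : MvPolynomial (Σ i : Fin d, Fin (a i + 1)) k) :
    MvPolynomial.eval z (scrollSubst a f) =
      MvPolynomial.eval (fun p => z (some p.1) * z none ^ (p.2 : ℕ)) f := by
  induction f using MvPolynomial.induction_on with
  | C c => simp [scrollSubst]
  | add f g hf hg => rw [map_add, map_add, hf, hg, map_add]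
  | mul_X f t hf =>
    rw [map_mul, map_mul, hf, map_mul]
    congr 1
    simp [scrollSubst]

theorem scrollSubst_monomial (δ : (Σ i : Fin d, Fin (a i + 1)) →₀ ℕ) :
    scrollSubst a (MvPolynomial.monomial δ (1 : k)) =
      MvPolynomial.monomial (substExponent a δ) 1 := by
  rw [scrollSubst, MvPolynomial.aeval_monomial, map_one, one_mul, substExponent,
    MvPolynomial.monomial_sum_one, Finsupp.prod_fintype _ _ fun _ => pow_zero _]
  refine Finset.prod_congr rfl fun p _ => ?_
  rw [← one_pow (M := k) (δ p), ← MvPolynomial.monomial_pow]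
  congr 1
  rw [← one_mul (1 : k), ← MvPolynomial.monomial_mul, MvPolynomial.X_pow_eq_monomial]
  rfl

theorem finrank_map_scrollSubst (m : ℕ) :
    Module.finrank k ((MvPolynomial.homogeneousSubmodule (Σ i : Fin d, Fin (a i + 1)) k m).map
      (scrollSubst a).toLinearMap) = (scrollExponents a m).card := by
  have hspan : (MvPolynomial.homogeneousSubmodule (Σ i : Fin d, Fin (a i + 1)) k m).map
      (scrollSubst a).toLinearMap = Submodule.span k (Set.range fun η : scrollExponents a m =>
        (MvPolynomial.monomial η.1 1 : MvPolynomial (Option (Fin d)) k)) := by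
    rw [MvPolynomial.homogeneousSubmodule_eq_finsupp_supported,
      AddMonoidAlgebra.supported_eq_span_single, Submodule.map_span]
    congr 1
    rw [← Set.image_comp]
    have h1 : ((scrollSubst a).toLinearMap : _ → MvPolynomial (Option (Fin d)) k) ∘
        (fun δ => MvPolynomial.monomial δ (1 : k)) =
        (fun η => MvPolynomial.monomial η 1) ∘ substExponent a :=
      funext fun δ => scrollSubst_monomial a δ
    change ((scrollSubst a).toLinearMap : _ → MvPolynomial (Option (Fin d)) k) ∘
        (fun δ => MvPolynomial.monomial δ (1 : k)) '' _ = _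
    rw [h1, Set.image_comp, image_substExponent, Set.image_eq_range]
    rfl
  rw [hspan, finrank_span_eq_card, Fintype.card_coe]
  exact (MvPolynomial.basisMonomials (Option (Fin d)) k).linearIndependent.comp _
    Subtype.val_injective

end Parametrization

section Scroll

variable {k : Type*} [Field k] {n d : ℕ}

/-- The rational normal scroll `S(a₁, …, a_d)` in the coordinates given by `e`. -/
def scroll (a : Fin d → ℕ) (e : (Fin (n + 1) → k) ≃ₗ[k] ((Σ i : Fin d, Fin (a i + 1)) → k)) :
    Set (ProjSpace k n) :=
  {P | ∃ (u w : k) (c : Fin d → k), (u ≠ 0 ∨ w ≠ 0) ∧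
      ∀ (i : Fin d) (j : Fin (a i + 1)),
        e P.rep ⟨i, j⟩ = c i * (u ^ (a i - (j : ℕ)) * w ^ (j : ℕ))}

variable (a : Fin d → ℕ) (e : (Fin (n + 1) → k) ≃ₗ[k] ((Σ i : Fin d, Fin (a i + 1)) → k))

/-- The homomorphism from the coordinate ring of projective space to the coordinate ring of the
affine parametrization of the scroll. -/
def scrollHom : CoordRing k n →ₐ[k] MvPolynomial (Option (Fin d)) k :=
  (scrollSubst a).comp (linearSubst e.symm.toLinearMap)

theorem eval_scrollHom (z : Option (Fin d) → k) (f : CoordRing k n) :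
    MvPolynomial.eval z (scrollHom a e f) =
      MvPolynomial.eval (e.symm fun p => z (some p.1) * z none ^ (p.2 : ℕ)) f := by
  rw [scrollHom, AlgHom.comp_apply, eval_scrollSubst, eval_linearSubst]
  rfl

theorem eval_aeval_polynomial {σ : Type*} (φ : σ → Polynomial k) (f : MvPolynomial σ k) (t : k) :
    (MvPolynomial.aeval φ f).eval t = MvPolynomial.eval (fun p => (φ p).eval t) f := by
  induction f using MvPolynomial.induction_on with
  | C c => simp [Polynomial.algebraMap_eq]
  | add f g hf hg => rw [map_add, Polynomial.eval_add, hf, hg, map_add]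
  | mul_X f i hf => simp [hf]

/-- A polynomial that vanishes on the part `u = 1` of the parametrization vanishes on the whole
scroll: the points with `u = 0` are limits of points with `u ≠ 0`. -/
theorem eval_eq_zero_of_scrollHom_eq_zero [Infinite k] {f : CoordRing k n}
    (hf : scrollHom a e f = 0) {u w : k} (c : Fin d → k) :
    MvPolynomial.eval (e.symm fun p => c p.1 * (u ^ (a p.1 - (p.2 : ℕ)) * w ^ (p.2 : ℕ))) f = 0 := by
  have hne : ∀ t : k, t ≠ 0 → MvPolynomial.eval
      (e.symm fun p => c p.1 * (t ^ (a p.1 - (p.2 : ℕ)) * w ^ (p.2 : ℕ))) f = 0 := fun t ht => by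
    have h := eval_scrollHom a e (fun o => o.elim (w / t) fun i => c i * t ^ a i) f
    rw [hf, map_zero] at h
    refine (congrArg (fun v => MvPolynomial.eval (e.symm v) f) ?_).trans h.symm
    funext p
    have hp : t ^ a p.1 = t ^ (a p.1 - (p.2 : ℕ)) * t ^ (p.2 : ℕ) := by
      rw [← pow_add, Nat.sub_add_cancel (Nat.lt_succ_iff.1 p.2.2)]
    simp only [Option.elim]
    rw [hp, div_pow]
    field_simp
  -- the polynomial in `u` obtained by restricting `f` to the parametrization
  let g : Polynomial k := MvPolynomial.aeval (fun p : Σ i : Fin d, Fin (a i + 1) =>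
    Polynomial.C (c p.1 * w ^ (p.2 : ℕ)) * Polynomial.X ^ (a p.1 - (p.2 : ℕ)))
    (linearSubst e.symm.toLinearMap f)
  have hg : ∀ t, g.eval t = MvPolynomial.eval
      (e.symm fun p => c p.1 * (t ^ (a p.1 - (p.2 : ℕ)) * w ^ (p.2 : ℕ))) f := fun t => by
    have h := eval_linearSubst e.symm.toLinearMap
      (fun p => c p.1 * (t ^ (a p.1 - (p.2 : ℕ)) * w ^ (p.2 : ℕ))) f
    refine Eq.trans ?_ h
    rw [eval_aeval_polynomial]
    refine congrArg (fun z => MvPolynomial.eval z (linearSubst e.symm.toLinearMap f)) ?_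
    funext p
    simp only [Polynomial.eval_mul, Polynomial.eval_C, Polynomial.eval_pow, Polynomial.eval_X]
    ring
  have hXg : Polynomial.X * g = 0 := Polynomial.funext fun t => by
    rw [Polynomial.eval_mul, Polynomial.eval_X, Polynomial.eval_zero, hg]
    by_cases ht : t = 0
    · rw [ht, zero_mul]
    · rw [hne t ht, mul_zero]
  rw [← hg, (mul_eq_zero.1 hXg).resolve_left Polynomial.X_ne_zero, Polynomial.eval_zero]

/-- In positive degree the ideal of the scroll is the kernel of `scrollHom`. -/
theorem mem_vanishingIdeal_scroll_iff [Infinite k] {m : ℕ} (hm : m ≠ 0) {f : CoordRing k n}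
    (hf : f.IsHomogeneous m) : f ∈ vanishingIdeal (scroll a e) ↔ scrollHom a e f = 0 := by
  constructor
  · intro hmem
    refine MvPolynomial.funext_iff.2 fun z => ?_
    rw [map_zero, eval_scrollHom]
    -- the zero vector is not a point, but forms of positive degree vanish there
    by_cases hv : (e.symm fun p => z (some p.1) * z none ^ (p.2 : ℕ)) = 0
    · rw [hv, MvPolynomial.eval_zero, MvPolynomial.constantCoeff_eq]
      exact hf.coeff_eq_zero (by simpa using hm.symm)
    · refine hmem (Projectivization.mk k _ hv) ?_ _ hv rfl
      obtain ⟨b, hb⟩ := Projectivization.exists_smul_eq_mk_rep k _ hv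
      -- the factor `b` accounts for the choice of the representative
      refine ⟨1, z none, fun i => b * z (some i), Or.inl one_ne_zero, fun i j => ?_⟩
      rw [← hb, Units.smul_def, map_smul, LinearEquiv.apply_symm_apply]
      simp [mul_assoc]
  · rintro h P ⟨u, w, c, -, hP⟩ v hv rfl
    obtain ⟨b, hb⟩ := Projectivization.exists_smul_eq_mk_rep k _ hv
    have hv' : v = e.symm fun p =>
        (↑b⁻¹ * c p.1) * (u ^ (a p.1 - (p.2 : ℕ)) * w ^ (p.2 : ℕ)) := by
      rw [LinearEquiv.eq_symm_apply]
      funext ⟨i, j⟩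
      have h1 := hP i j
      rw [← hb, Units.smul_def, map_smul, Pi.smul_apply, smul_eq_mul] at h1
      rw [mul_assoc, ← h1, Units.inv_mul_cancel_left]
    have h2 := eval_eq_zero_of_scrollHom_eq_zero a e h (u := u) (w := w) fun i => ↑b⁻¹ * c i
    rwa [← hv'] at h2

theorem finrank_map_eq_of_ker_eq {M M₁ M₂ : Type*} [AddCommGroup M] [AddCommGroup M₁]
    [AddCommGroup M₂] [Module k M] [Module k M₁] [Module k M₂] (p : Submodule k M)
    (f : M →ₗ[k] M₁) (g : M →ₗ[k] M₂) (h : ∀ x ∈ p, f x = 0 ↔ g x = 0) :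
    Module.finrank k (p.map f) = Module.finrank k (p.map g) := by
  rw [← LinearMap.range_domRestrict, ← LinearMap.range_domRestrict]
  have hker : LinearMap.ker (f.domRestrict p) = LinearMap.ker (g.domRestrict p) := by
    ext x
    exact h x x.2
  exact ((f.domRestrict p).quotKerEquivRange.symm.trans
    ((Submodule.quotEquivOfEq _ _ hker).trans (g.domRestrict p).quotKerEquivRange)).finrank_eq

theorem hilbertFunction_scroll [Infinite k] {m : ℕ} (hm : m ≠ 0) :
    hilbertFunction (scroll a e) m = (scrollExponents a m).card := by
  rw [hilbertFunction, finrank_map_eq_of_ker_eq _ _ (scrollHom a e).toLinearMap,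
    ← finrank_map_scrollSubst (k := k) a m,
    ← map_linearSubst_homogeneousSubmodule e.symm m, ← Submodule.map_comp]
  · rfl
  · intro f hf
    rw [AlgHom.toLinearMap_apply, Ideal.Quotient.mkₐ_eq_mk, Ideal.Quotient.eq_zero_iff_mem]
    exact mem_vanishingIdeal_scroll_iff a e hm hf

theorem hasDegree_hasCodimension_scroll [Infinite k] (ha : ∃ i, 0 < a i) :
    HasDegree (scroll a e) (∑ i, a i) ∧ ∀ c, d + c = n → HasCodimension (scroll a e) c := by
  obtain ⟨d, rfl⟩ : ∃ d', d = d' + 1 := by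
    obtain ⟨i, -⟩ := ha
    exact ⟨d - 1, (Nat.sub_add_cancel (Nat.one_le_of_lt i.2)).symm⟩
  obtain ⟨hne, hdeg, hlead⟩ := scrollPolynomial_natDegree_leadingCoeff ha
  have hH : IsHilbertPolynomial (scroll a e) (scrollPolynomial a) := by
    filter_upwards [Filter.eventually_ne_atTop 0] with m hm
    rw [hilbertFunction_scroll a e hm, card_scrollExponents_eq_eval]
  exact ⟨⟨_, hne, hH, by rw [hdeg, hlead]⟩, fun c hc => ⟨_, hne, hH, by rw [hdeg, hc]⟩⟩

end Scroll

/-! ### From a matrix of linear forms to a scroll -/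

section Nondegenerate

variable {k : Type*} [Field k] {n : ℕ} {X : Set (ProjSpace k n)}

theorem vanishesAt_of_eval_rep_eq_zero {f : CoordRing k n} (hf : f.IsHomogeneous 1)
    {P : ProjSpace k n} (h : MvPolynomial.eval P.rep f = 0) : VanishesAt f P := by
  rintro v hv rfl
  obtain ⟨b, hb⟩ := Projectivization.exists_smul_eq_mk_rep k v hv
  rw [← hb, Units.smul_def, eval_smul_of_isHomogeneous_one hf] at h
  exact (mul_eq_zero.1 h).resolve_left b.ne_zero

theorem eval_rep_eq_zero {f : CoordRing k n} {P : ProjSpace k n} (hP : P ∈ X)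
    (hf : f ∈ vanishingIdeal X) : MvPolynomial.eval P.rep f = 0 :=
  hf P hP P.rep P.rep_nonzero P.mk_rep

/-- The ideal of an irreducible nondegenerate variety contains no quadric of rank at most two. -/
theorem eq_zero_or_eq_zero_of_mul_mem (hX : IsIrreducibleVariety X) (hnd : IsNondegenerate X)
    {f g : CoordRing k n} (hf : f.IsHomogeneous 1) (hg : g.IsHomogeneous 1)
    (hfg : f * g ∈ vanishingIdeal X) : f = 0 ∨ g = 0 := by
  have hcover : X ⊆ projZeros {f} ∪ projZeros {g} := fun P hP => by
    have h := eval_rep_eq_zero hP hfg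
    rw [map_mul] at h
    rcases mul_eq_zero.1 h with h | h
    · left
      rintro _ rfl
      exact vanishesAt_of_eval_rep_eq_zero hf h
    · right
      rintro _ rfl
      exact vanishesAt_of_eval_rep_eq_zero hg h
  rcases hX.2.2 _ _ ⟨_, rfl⟩ ⟨_, rfl⟩ hcover with h | h
  · exact Or.inl (hnd f hf fun P hP => h hP f rfl)
  · exact Or.inr (hnd g hg fun P hP => h hP g rfl)

theorem eq_zero_of_mem_vanishingIdeal (hX : X.Nonempty) (hnd : IsNondegenerate X)
    {f : CoordRing k n} (hf : f ∈ vanishingIdeal X) {m : ℕ} (hm : m < 2)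
    (hhom : f.IsHomogeneous m) : f = 0 := by
  interval_cases m
  · rw [← MvPolynomial.totalDegree_zero_iff_isHomogeneous,
      MvPolynomial.totalDegree_eq_zero_iff_eq_C] at hhom
    obtain ⟨P, hP⟩ := hX
    have h := eval_rep_eq_zero hP hf
    rw [hhom, MvPolynomial.eval_C] at h
    rw [hhom, h, map_zero]
  · exact hnd f hhom hf

end Nondegenerate

section Pencil

variable {k : Type*} [Field k] {n : ℕ}

/-- A sequence with constant ratio `w / u`, where `u = 0` is allowed, lies on the cone over the
rational normal curve. -/
theorem exists_eq_mul_pow_mul_pow {u w : k} (huw : u ≠ 0 ∨ w ≠ 0) {m : ℕ} {f : ℕ → k}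
    (hf : ∀ j < m, w * f j = u * f (j + 1)) :
    ∃ c, ∀ j ≤ m, f j = c * (u ^ (m - j) * w ^ j) := by
  by_cases hu : u = 0
  · have hw := huw.resolve_left (not_not.2 hu)
    refine ⟨f m / w ^ m, fun j hj => ?_⟩
    rcases hj.eq_or_lt with rfl | hlt
    · field_simp
      simp
    · have h := hf j hlt
      rw [hu, zero_mul] at h
      rw [(mul_eq_zero.1 h).resolve_left hw, hu, zero_pow (by omega), zero_mul, mul_zero]
  · refine ⟨f 0 / u ^ m, fun j hj => ?_⟩
    have hpow : u ^ j * f j = w ^ j * f 0 := by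
      induction j with
      | zero => simp
      | succ j ih =>
        have h1 := ih (by omega)
        have h2 := hf j hj
        rw [pow_succ, pow_succ, mul_assoc, ← h2]
        linear_combination w * h1
    have hm : u ^ m = u ^ (m - j) * u ^ j := by rw [← pow_add, Nat.sub_add_cancel hj]
    rw [hm]
    field_simp
    linear_combination hpow

/-- If `β x * α y = β y * α x` for all `x, y`, then the points `[α x : β x]` of the projective line
that are defined all agree. -/
theorem exists_ratio {M : Type*} {U : Set M} {α β : M → k}
    (h : ∀ x ∈ U, ∀ y ∈ U, β x * α y = β y * α x) :
    ∃ u w : k, (u ≠ 0 ∨ w ≠ 0) ∧ ∀ x ∈ U, w * α x = u * β x := by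
  by_cases hex : ∃ x ∈ U, α x ≠ 0 ∨ β x ≠ 0
  · obtain ⟨x, hx, hne⟩ := hex
    exact ⟨α x, β x, hne, fun y hy => by rw [h x hx y hy, mul_comm]⟩
  · push Not at hex
    exact ⟨1, 0, Or.inl one_ne_zero, fun x hx => by rw [(hex x hx).2]; ring⟩

/-- Evaluation at a basis of the space of linear forms is a system of linear coordinates. -/
theorem exists_coordinates [Infinite k] {ι : Type*} [Fintype ι] [DecidableEq ι]
    {b : ι → CoordRing k n} (hli : LinearIndependent k b)
    (hspan : Submodule.span k (Set.range b) = MvPolynomial.homogeneousSubmodule _ k 1) :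
    ∃ e : (Fin (n + 1) → k) ≃ₗ[k] (ι → k), ∀ v i, e v i = MvPolynomial.eval v (b i) := by
  have hb : ∀ i, (b i).IsHomogeneous 1 := fun i =>
    hspan.le (Submodule.subset_span ⟨i, rfl⟩)
  let Φ : (Fin (n + 1) → k) →ₗ[k] (ι → k) :=
    { toFun := fun v i => MvPolynomial.eval v (b i)
      map_add' := fun v w => funext fun i => eval_add_of_isHomogeneous_one (hb i) v w
      map_smul' := fun c v => funext fun i => eval_smul_of_isHomogeneous_one (hb i) c v }
  have hinj : Function.Injective Φ := by
    refine (injective_iff_map_eq_zero Φ).2 fun v hv => funext fun i => ?_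
    have hmem : (MvPolynomial.X i : CoordRing k n) ∈ Submodule.span k (Set.range b) :=
      hspan.ge (MvPolynomial.isHomogeneous_X k i)
    have hle : Submodule.span k (Set.range b) ≤
        LinearMap.ker (MvPolynomial.aeval v : CoordRing k n →ₐ[k] k).toLinearMap := by
      refine Submodule.span_le.2 ?_
      rintro _ ⟨j, rfl⟩
      exact (RingHom.congr_fun (MvPolynomial.coe_aeval_eq_eval v) (b j)).trans (congrFun hv j)
    simpa using hle hmem
  have hsurj : Function.Surjective Φ := fun z => by
    obtain ⟨w, hw⟩ := exists_dual_points hb hli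
    refine ⟨∑ m, z m • w m, funext fun i => ?_⟩
    have hΦ : ∀ m, Φ (w m) i = if i = m then 1 else 0 := fun m => hw i m
    rw [map_sum, Finset.sum_apply]
    simp [hΦ]
  exact ⟨LinearEquiv.ofBijective Φ ⟨hinj, hsurj⟩, fun v i => rfl⟩

end Pencil

section Scroll

variable {k : Type*} [Field k] {n g : ℕ} {X : Set (ProjSpace k n)}

theorem minor_mem_of_mem_span {I : Ideal (CoordRing k n)} {l a : Fin g → CoordRing k n}
    {N : CoordRing k n →ₗ[k] CoordRing k n} (hN : ∀ j, N (l j) = a j)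
    (hminor : ∀ i j, a i * l j - a j * l i ∈ I) {x y : CoordRing k n}
    (hx : x ∈ Submodule.span k (Set.range l)) (hy : y ∈ Submodule.span k (Set.range l)) :
    N x * y - N y * x ∈ I := by
  obtain ⟨c, rfl⟩ := (Submodule.mem_span_range_iff_exists_fun k).1 hx
  obtain ⟨c', rfl⟩ := (Submodule.mem_span_range_iff_exists_fun k).1 hy
  have hsum : N (∑ i, c i • l i) * ∑ j, c' j • l j - N (∑ j, c' j • l j) * ∑ i, c i • l i =
      ∑ i, ∑ j, (c i * c' j) • (a i * l j - a j * l i) := by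
    simp only [map_sum, map_smul, hN, Finset.sum_mul_sum, smul_sub, Finset.sum_sub_distrib]
    congr 1
    · simp only [smul_mul_smul_comm]
    · rw [Finset.sum_comm]
      simp only [smul_mul_smul_comm, mul_comm (c' _)]
  rw [hsum]
  refine Ideal.sum_mem _ fun i _ => Ideal.sum_mem _ fun j _ => ?_
  rw [MvPolynomial.smul_eq_C_mul]
  exact Ideal.mul_mem_left _ _ (hminor i j)

/-- The matrix with rows `l` and `N l` is `1`-generic: an eigenvector of `N` would give a quadric
of rank two in the ideal unless the rows are proportional, in which case all minors vanish. -/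
theorem eq_zero_of_apply_eq_smul (hX : IsIrreducibleVariety X) (hnd : IsNondegenerate X)
    {l : Fin g → CoordRing k n} (hl : ∀ j, (l j).IsHomogeneous 1)
    {N : CoordRing k n →ₗ[k] CoordRing k n} (hN : ∀ j, (N (l j)).IsHomogeneous 1)
    (hminor : ∀ i j, N (l i) * l j - N (l j) * l i ∈ vanishingIdeal X)
    (hne : ∃ i j, N (l i) * l j - N (l j) * l i ≠ 0)
    {u : CoordRing k n} (hu : u ∈ Submodule.span k (Set.range l)) {c : k} (hc : N u = c • u) :
    u = 0 := by
  by_contra hu0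
  have hhu : u.IsHomogeneous 1 := by
    have hle : Submodule.span k (Set.range l) ≤ MvPolynomial.homogeneousSubmodule _ k 1 :=
      Submodule.span_le.2 (by rintro _ ⟨j, rfl⟩; exact hl j)
    exact hle hu
  have hprop : ∀ j, N (l j) = c • l j := fun j => by
    have h := minor_mem_of_mem_span (fun _ => rfl) hminor hu (Submodule.subset_span ⟨j, rfl⟩)
    have hfactor : N u * l j - N (l j) * u = u * (c • l j - N (l j)) := by
      rw [hc, MvPolynomial.smul_eq_C_mul, MvPolynomial.smul_eq_C_mul]
      ring
    rw [hfactor] at h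
    have hhom : (c • l j - N (l j)).IsHomogeneous 1 := by
      rw [MvPolynomial.smul_eq_C_mul]
      exact ((hl j).C_mul c).sub (hN j)
    exact (sub_eq_zero.1 ((eq_zero_or_eq_zero_of_mul_mem hX hnd hhu hhom h).resolve_left
      hu0)).symm
  obtain ⟨i, j, hij⟩ := hne
  refine hij ?_
  rw [hprop i, hprop j, MvPolynomial.smul_eq_C_mul, MvPolynomial.smul_eq_C_mul]
  ring

/-- A point at which the minors of the matrix with rows `l` and `N l` vanish lies on the scroll
that is described by a basis of linear forms consisting of chains for `N`. -/
theorem mem_scroll_of_minors {d : ℕ} {b : Fin d → ℕ} {x : Fin d → CoordRing k n}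
    {N : CoordRing k n →ₗ[k] CoordRing k n}
    {e : (Fin (n + 1) → k) ≃ₗ[k] ((Σ i : Fin d, Fin (b i + 1)) → k)}
    (he : ∀ v p, e v p = MvPolynomial.eval v (chain N (fun i => b i + 1) x p))
    {P : ProjSpace k n}
    (hP : ∀ f ∈ Submodule.span k (Set.range (chain N b x)),
      ∀ f' ∈ Submodule.span k (Set.range (chain N b x)),
      MvPolynomial.eval P.rep (N f) * MvPolynomial.eval P.rep f' =
        MvPolynomial.eval P.rep (N f') * MvPolynomial.eval P.rep f) :
    P ∈ scroll b e := by
  obtain ⟨u, w, huw, hratio⟩ := exists_ratio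
    (U := (Submodule.span k (Set.range (chain N b x)) : Set (CoordRing k n)))
    (α := fun f => MvPolynomial.eval P.rep f) (β := fun f => MvPolynomial.eval P.rep (N f)) hP
  have hrow : ∀ i, ∃ c, ∀ j ≤ b i, MvPolynomial.eval P.rep ((N ^ j) (x i)) =
      c * (u ^ (b i - j) * w ^ j) := fun i => by
    refine exists_eq_mul_pow_mul_pow huw fun j hj => ?_
    have h := hratio ((N ^ j) (x i)) (chain_mem_span N b x hj)
    rwa [← Module.End.mul_apply, ← pow_succ'] at h
  choose c hc using hrow
  exact ⟨u, w, c, huw, fun i j => (he _ _).trans (hc i j (Nat.lt_succ_iff.1 j.2))⟩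

/-- An irreducible nondegenerate variety on which the `2 × 2` minors of a matrix of linear forms
vanish, one row of which is independent and not all of whose minors are zero, lies on a scroll of
codimension one less than the number of columns. -/
theorem exists_scroll_of_minors_mem [IsAlgClosed k] (hX : IsIrreducibleVariety X)
    (hnd : IsNondegenerate X) (hg : g ≠ 0) {l a : Fin g → CoordRing k n}
    (hl : ∀ j, (l j).IsHomogeneous 1) (hli : LinearIndependent k l)
    (ha : ∀ j, (a j).IsHomogeneous 1)
    (hminor : ∀ i j, a i * l j - a j * l i ∈ vanishingIdeal X)
    (hne : ∃ i j, a i * l j - a j * l i ≠ 0) :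
    ∃ (d : ℕ) (b : Fin d → ℕ)
      (e : (Fin (n + 1) → k) ≃ₗ[k] ((Σ i : Fin d, Fin (b i + 1)) → k)),
      ∑ i, b i = g ∧ d + g = n + 1 ∧ (∃ i, 0 < b i) ∧ X ⊆ scroll b e := by
  have : Infinite k := IsAlgClosed.instInfinite
  obtain ⟨N, hN⟩ := LinearMap.exists_extend ((Module.Basis.span hli).constr k a)
  have hNl : ∀ j, N (l j) = a j := fun j => by
    have h := LinearMap.congr_fun hN (Module.Basis.span hli j)
    rw [Module.Basis.constr_basis] at h
    rw [← h, LinearMap.comp_apply, Submodule.subtype_apply, Module.Basis.span_apply]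
  have hmem := fun x hx y hy => minor_mem_of_mem_span (x := x) (y := y) hNl hminor hx hy
  obtain rfl : a = fun j => N (l j) := funext fun j => (hNl j).symm
  have hfin : FiniteDimensional k (MvPolynomial.homogeneousSubmodule (Fin (n + 1)) k 1) :=
    Module.Finite.iff_fg.2 (MvPolynomial.homogeneousSubmodule_fg (Fin (n + 1)) k 1)
  obtain ⟨d, b, x, hli', hV, hU⟩ := exists_fin_chain_basis N (Submodule.span k (Set.range l))
    (MvPolynomial.homogeneousSubmodule (Fin (n + 1)) k 1)
    (Submodule.span_le.2 (by rintro _ ⟨j, rfl⟩; exact hl j))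
    (by
      rw [Submodule.map_span, Submodule.span_le]
      rintro _ ⟨_, ⟨j, rfl⟩, rfl⟩
      exact ha j)
    fun u hu c hc => eq_zero_of_apply_eq_smul hX hnd hl ha hminor hne hu hc
  obtain ⟨e, he⟩ := exists_coordinates hli' hV
  have hsum : ∑ i, b i = g := by
    have h1 := finrank_span_eq_card (linearIndependent_chain N hli')
    rw [hU, finrank_span_eq_card hli] at h1
    simpa using h1.symm
  have hdim : d + g = n + 1 := by
    have h1 := e.finrank_eq
    simp only [Module.finrank_fintype_fun_eq_card, Fintype.card_sigma, Fintype.card_fin,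
      Finset.sum_add_distrib, hsum, Finset.sum_const, Finset.card_univ, smul_eq_mul, mul_one] at h1
    omega
  refine ⟨d, b, e, hsum, hdim, ?_, fun P hP => mem_scroll_of_minors he fun f hf f' hf' => ?_⟩
  · by_contra! h
    exact hg (hsum ▸ Finset.sum_eq_zero fun i _ => Nat.le_zero.1 (h i))
  · rw [hU] at hf hf'
    have h := eval_rep_eq_zero hP (hmem f hf f' hf')
    rw [map_sub, map_mul, map_mul] at h
    exact sub_eq_zero.1 h

end Scroll

end ScrollarSyzygy

end

theorem mainTheorem8 {k : Type*} [Field k] [IsAlgClosed k] {n p : ℕ} (hp : 1 ≤ p)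
    (X : Set (ScrollarSyzygy.ProjSpace k n))
    (hX : ScrollarSyzygy.IsIrreducibleVariety X)
    (hnd : ScrollarSyzygy.IsNondegenerate X)
    (hquad : ScrollarSyzygy.IsGeneratedByQuadrics (ScrollarSyzygy.vanishingIdeal X))
    (F : ScrollarSyzygy.MinimalFreeResolution (ScrollarSyzygy.vanishingIdeal X))
    (s : F.LinearSyzygy p) (hs : F.syzygyRank s = p + 2) :
    ∃ Y : Set (ScrollarSyzygy.ProjSpace k n),
      ScrollarSyzygy.IsRationalNormalScroll Y ∧
      ScrollarSyzygy.HasDegree Y (p + 2) ∧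
      ScrollarSyzygy.HasCodimension Y (p + 1) ∧
      X ⊆ Y := by
  obtain ⟨q, rfl⟩ : ∃ q, p = q + 1 := ⟨p - 1, (Nat.sub_add_cancel hp).symm⟩
  have : Infinite k := IsAlgClosed.instInfinite
  obtain ⟨l, a, hl, hli, ha, hminor, hne⟩ :=
    ScrollarSyzygy.MinimalFreeResolution.exists_matrix_of_syzygyRank_eq
      (fun f hf m hm hhom => ScrollarSyzygy.eq_zero_of_mem_vanishingIdeal hX.2.1 hnd hf hm hhom)
      s hs
  obtain ⟨d, b, e, hsum, hdim, hpos, hsub⟩ :=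
    ScrollarSyzygy.exists_scroll_of_minors_mem hX hnd (Nat.succ_ne_zero (q + 2)) hl hli ha hminor hne
  obtain ⟨hdeg, hcodim⟩ := ScrollarSyzygy.hasDegree_hasCodimension_scroll b e hpos
  exact ⟨ScrollarSyzygy.scroll b e, ⟨d, b, e, hpos, rfl⟩, by rwa [hsum] at hdeg,
    hcodim _ (by omega), hsub⟩
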